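/- Let $M$ be a smooth (Hausdorff, finite-dimensional, real, boundaryless) manifold and equip $TM$ with its standard Lie algebroid structure (Lie bracket of vector fields, anchor the identity). For $m\in M$ let $\mathfrak{D}(TM)_m$ be the space of $\mathbb{R}$-linear operators $\mathfrak{d}:\Gamma(TM)\to T_mM$ together with a tangent vector $x=\alpha(\mathfrak{d})\in T_mM$ (the anchor) such that $\mathfrak{d}(fu)=f(m)\,\mathfrak{d}(u)+x(f)\,u(m)$ for all $f\in C^\infty(M)$, $u\in\Gamma(TM)$. The gauge algebroid $\mathfrak{D}(TM)$ has anchor $\alpha$ and the commutator of operators as bracket; $\mathbf{i}:\mathfrak{gl}(TM)\to\mathfrak{D}(TM)$ is the inclusion $\Phi\mapsto(u\mapsto\Phi(u(m)))$. Let $\mathfrak{J}(TM)$ be the first jet bundle of $TM$, with fibre $\{[u]_m: u\in\Gamma(TM)\}$, projection $\mathbf{p}([u]_m)=u(m)$, prolongation $\mathbf{d}u=(m\mapsto[u]_m)$, $TM$-valued pairing $\langle[u]_m,\mathfrak{d}\rangle=\mathfrak{d}(u)$ with $\mathfrak{D}(TM)$, and inclusion $\mathbf{e}:\mathfrak{gl}(TM)=\mathrm{Hom}(TM,TM)\to\mathfrak{J}(TM)$,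 $\langle\mathbf{e}(y),\mathfrak{d}\rangle=y(\alpha(\mathfrak{d}))$. Put $\pi([u]_m)=[u,\cdot\,](m)$ and $\langle\mathfrak{L}_{\mathfrak{d}}\mu,\mathfrak{d}'\rangle=\mathfrak{d}\langle\mu,\mathfrak{d}'\rangle-\langle\mu,[\mathfrak{d},\mathfrak{d}']\rangle$, and equip $\mathfrak{J}(TM)$ with the anchor $\alpha\circ\pi$ and the bracket $$[\mu,\nu]=\mathfrak{L}_{\pi(\mu)}\nu-\mathfrak{L}_{\pi(\nu)}\mu-\mathbf{d}\langle\pi(\mu),\nu\rangle ,\qquad \mu,\nu\in\Gamma(\mathfrak{J}(TM)).$$ Then $TM$, $\mathfrak{gl}(TM)$ (commutator bracket, zero anchor), $\mathfrak{gl}(TM)^{op}$ (opposite bracket, zero anchor), $\mathfrak{D}(TM)$ and $\mathfrak{J}(TM)$ are Lie algebroids over $M$; the jet sequence and the Atiyah sequence $$0\to\mathfrak{gl}(TM)^{op}\xrightarrow{\ \mathbf{e}\ }\mathfrak{J}(TM)\xrightarrow{\ \mathbf{p}\ }TM\to0,\qquad 0\to\mathfrak{gl}(TM)\xrightarrow{\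 \mathbf{i}\ }\mathfrak{D}(TM)\xrightarrow{\ \alpha\ }TM\to0$$ are exact sequences of Lie algebroid morphisms; and there is a Lie algebroid isomorphism $\hat{\mathbf{i}}_{TM}:\mathfrak{J}(TM)\to\mathfrak{D}(TM)$ over the identity of $M$, given canonically by $\hat{\mathbf{i}}_{TM}([u]_m)=[u,\cdot\,](m)$ (with anchor $u(m)$), such that $$\hat{\mathbf{i}}_{TM}\circ\mathbf{e}=\mathbf{i}\circ(-\mathbf{1}_{\mathfrak{gl}(TM)}),\qquad \alpha\circ\hat{\mathbf{i}}_{TM}=\mathbf{1}_{TM}\circ\mathbf{p}.$$ -/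

import Mathlib

open Bundle VectorField
open scoped Manifold ContDiff Topology

set_option linter.unusedSectionVars false

noncomputable section

namespace JetGauge

section Basics

variable (E : Type*) [NormedAddCommGroup E] [NormedSpace ℝ E]
  {M : Type*} [TopologicalSpace M] [ChartedSpace E M]

/-- The tangent space `T_m M`. -/
abbrev Tang (m : M) : Type _ := TangentSpace 𝓘(ℝ, E) m

variable (M)

/-- Smooth real-valued functions on `M`. -/
abbrev SmoothFn : Type _ := C^∞⟮𝓘(ℝ, E), M; ℝ⟯

variable [IsManifold 𝓘(ℝ, E) ∞ M]

instance : IsManifold 𝓘(ℝ, E) (minSmoothness ℝ 3) M :=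
  IsManifold.of_le (n := ∞) (by
    rw [minSmoothness_of_isRCLikeNormedField]; exact ENat.LEInfty.out)

/-- `Γ(TM)`: smooth vector fields on `M`. -/
abbrev VField : Type _ := Cₛ^∞⟮𝓘(ℝ, E); E, (fun m : M => Tang E m)⟯

instance : AddCommGroup (VField E M) := inferInstance
instance : AddCommMonoid (VField E M) := inferInstance
instance : AddGroup (VField E M) := inferInstance
instance : AddMonoid (VField E M) := inferInstance
instance : AddZeroClass (VField E M) := inferInstance
instance : Module ℝ (VField E M) := inferInstance

/-- `Γ(T*M)`: smooth one-forms on `M`. -/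
abbrev OneForm : Type _ :=
  Cₛ^∞⟮𝓘(ℝ, E); E →L[ℝ] ℝ, (fun m : M => Tang E m →L[ℝ] Bundle.Trivial M ℝ m)⟯

variable {M} {E}

/-- The product `f u` of a smooth function and a smooth vector field. -/
def fsmul (f : SmoothFn E M) (u : VField E M) : VField E M :=
  ⟨fun m => f m • u m, f.contMDiff.smul_section u.contMDiff⟩

@[simp] lemma fsmul_apply (f : SmoothFn E M) (u : VField E M) (m : M) :
    fsmul f u m = f m • u m := rfl

/-- The Lie bracket of smooth vector fields. -/
def vbracket [FiniteDimensional ℝ E] (u v : VField E M) : VField E M :=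
  ⟨fun m => mlieBracket 𝓘(ℝ, E) u v m, by
    have : IsManifold 𝓘(ℝ, E) (((⊤ : ℕ∞) : WithTop ℕ∞) + 1) M := ‹IsManifold 𝓘(ℝ, E) ∞ M›
    have := FiniteDimensional.complete ℝ E
    have := ContDiff.mlieBracket_vectorField (𝕜 := ℝ) (I := 𝓘(ℝ, E)) (m := ⊤) (n := ⊤)
      u.contMDiff v.contMDiff (by simp [minSmoothness_of_isRCLikeNormedField])
    exact this⟩

lemma vbracket_apply [FiniteDimensional ℝ E] (u v : VField E M) (m : M) :
    vbracket u v m = mlieBracket 𝓘(ℝ, E) u v m := rfl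

/-- The derivative `X(f)` of a smooth function along a smooth vector field. -/
def dir (X : VField E M) (f : SmoothFn E M) : SmoothFn E M :=
  ⟨fun m => mvfderiv 𝓘(ℝ, E) f m (X m), by
    have h1 : ContMDiff 𝓘(ℝ, E).tangent 𝓘(ℝ, ℝ).tangent ∞ (tangentMap 𝓘(ℝ, E) 𝓘(ℝ, ℝ) f) :=
      f.contMDiff.contMDiff_tangentMap (by simp)
    exact (contMDiff_snd_tangentBundle_modelSpace ℝ 𝓘(ℝ, ℝ)).comp (h1.comp X.contMDiff)⟩

lemma dir_apply (X : VField E M) (f : SmoothFn E M) (m : M) :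
    dir X f m = mvfderiv 𝓘(ℝ, E) f m (X m) := rfl


/-- The contraction of a one-form with a vector field. -/
def contract (ξ : OneForm E M) (u : VField E M) : SmoothFn E M :=
  ⟨fun m => ξ m (u m), by
    have h := ContMDiff.clm_bundle_apply (IB := 𝓘(ℝ, E)) (F₂ := ℝ) ξ.contMDiff u.contMDiff
    intro m
    exact ((contMDiffAt_section m).1 (h m))⟩

lemma contract_apply (ξ : OneForm E M) (u : VField E M) (m : M) : contract ξ u m = ξ m (u m) := rfl

section Calculus

@[simp] lemma dir_fsmul (f : SmoothFn E M) (X : VField E M) (g : SmoothFn E M) (m : M) :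
    dir (fsmul f X) g m = f m * dir X g m := by
  simp [dir_apply]

lemma mdiff_fn (f : SmoothFn E M) (m : M) : MDifferentiableAt 𝓘(ℝ, E) 𝓘(ℝ, ℝ) f m :=
  f.contMDiff.mdifferentiableAt (by simp)

lemma mdiff_field (u : VField E M) (m : M) :
    MDifferentiableAt 𝓘(ℝ, E) 𝓘(ℝ, E).tangent (fun p => (⟨p, u p⟩ : TangentBundle 𝓘(ℝ, E) M)) m :=
  u.contMDiff.mdifferentiableAt (by simp)

variable [FiniteDimensional ℝ E]

lemma vbracket_fsmul_right (u v : VField E M) (f : SmoothFn E M) :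
    vbracket u (fsmul f v) = fsmul f (vbracket u v) + fsmul (dir u f) v := by
  have := FiniteDimensional.complete ℝ E
  ext m
  have := mlieBracket_smul_right (I := 𝓘(ℝ, E)) (V := u) (mdiff_fn f m) (mdiff_field v m)
  exact this.trans (add_comm _ _)

lemma vbracket_swap (u v : VField E M) : vbracket u v = - vbracket v u := by
  ext m
  exact mlieBracket_swap_apply

lemma vbracket_add_right (u v w : VField E M) :
    vbracket u (v + w) = vbracket u v + vbracket u w := by
  have := FiniteDimensional.complete ℝ E
  ext m
  exact mlieBracket_add_right (V := u) (mdiff_field v m) (mdiff_field w m)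

lemma vbracket_smul_right (u : VField E M) (c : ℝ) (v : VField E M) :
    vbracket u (c • v) = c • vbracket u v := by
  have := FiniteDimensional.complete ℝ E
  ext m
  exact mlieBracket_const_smul_right (V := u) (mdiff_field v m)

lemma vbracket_add_left (u v w : VField E M) :
    vbracket (u + v) w = vbracket u w + vbracket v w := by
  rw [vbracket_swap, vbracket_add_right, vbracket_swap w u, vbracket_swap w v]; abel

lemma vbracket_smul_left (c : ℝ) (u v : VField E M) :
    vbracket (c • u) v = c • vbracket u v := by
  rw [vbracket_swap, vbracket_smul_right, vbracket_swap v u, smul_neg, neg_neg]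

lemma vbracket_fsmul_left (u v : VField E M) (f : SmoothFn E M) :
    vbracket (fsmul f u) v = fsmul f (vbracket u v) - fsmul (dir v f) u := by
  rw [vbracket_swap, vbracket_fsmul_right, vbracket_swap v u]
  ext m; simp; abel

lemma vbracket_jacobi (u v w : VField E M) :
    vbracket u (vbracket v w) = vbracket (vbracket u v) w + vbracket v (vbracket u w) := by
  have := FiniteDimensional.complete ℝ E
  ext m
  have h2 : ∀ (x : VField E M), ContMDiffAt 𝓘(ℝ, E) 𝓘(ℝ, E).tangent (minSmoothness ℝ 2)
      (fun p => (⟨p, x p⟩ : TangentBundle 𝓘(ℝ, E) M)) m := fun x =>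
    (x.contMDiff m).of_le (by
      rw [minSmoothness_of_isRCLikeNormedField]; exact ENat.LEInfty.out)
  exact leibniz_identity_mlieBracket_apply (h2 u) (h2 v) (h2 w)

/-- The identity `[X, Y](f) = X(Y(f)) - Y(X(f))`, multiplied by an arbitrary vector field. -/
lemma dir_vbracket_smul (X Y Z : VField E M) (f : SmoothFn E M) (m : M) :
    dir (vbracket X Y) f m • Z m = (dir X (dir Y f) m - dir Y (dir X f) m) • Z m := by
  have h := congrArg (fun s : VField E M => s m) (vbracket_jacobi X Y (fsmul f Z))
  simp only [vbracket_fsmul_right, vbracket_add_right, ContMDiffSection.coe_add, Pi.add_apply,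
    fsmul_apply] at h
  have h' := congrArg (fun s : VField E M => s m) (vbracket_jacobi X Y Z)
  simp only [ContMDiffSection.coe_add, Pi.add_apply] at h'
  rw [h'] at h
  rw [sub_smul]
  rw [smul_add] at h
  rw [← sub_eq_zero] at h ⊢
  rw [← neg_eq_zero, ← h]
  module

end Calculus

/-! ### The gauge algebroid of `TM` -/

section Gauge

/-- The fibre at `m` of the gauge algebroid of `TM`: pairs of an `ℝ`-linear operator
`d : Γ(TM) → T_m M` and a tangent vector `x`, the anchor, with `d(f u) = f(m) d(u) + x(f) u(m)`. -/
def gaugeFiber (m : M) : Submodule ℝ ((VField E M →ₗ[ℝ] Tang E m) × Tang E m) where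
  carrier := {d | ∀ (f : SmoothFn E M) (u : VField E M),
    d.1 (fsmul f u) = f m • d.1 u + mvfderiv 𝓘(ℝ, E) f m d.2 • u m}
  add_mem' := by
    intro a b ha hb f u
    simp only [Prod.fst_add, LinearMap.add_apply, ha f u, hb f u, Prod.snd_add, map_add, smul_add,
      add_smul]
    abel
  zero_mem' := by intro f u; simp
  smul_mem' := by
    intro c a ha f u
    simp only [Prod.smul_fst, LinearMap.smul_apply, ha f u, Prod.smul_snd, map_smul, smul_add,
      smul_smul, smul_eq_mul, mul_comm c]

variable (E) in
/-- The fibre `𝔇(TM)_m`. -/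
abbrev Gauge (m : M) : Type _ := ↥(gaugeFiber (E := E) m)

instance (m : M) : AddCommGroup (Gauge E m) := inferInstance
instance (m : M) : AddCommMonoid (Gauge E m) := inferInstance
instance (m : M) : AddGroup (Gauge E m) := inferInstance
instance (m : M) : AddMonoid (Gauge E m) := inferInstance
instance (m : M) : AddZeroClass (Gauge E m) := inferInstance
instance (m : M) : Module ℝ (Gauge E m) := inferInstance

/-- The operator `Γ(TM) → T_m M` underlying an element of `𝔇(TM)_m`. -/
def gaugeOp (m : M) : Gauge E m →ₗ[ℝ] (VField E M →ₗ[ℝ] Tang E m) :=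
  (LinearMap.fst ℝ _ _).comp (gaugeFiber m).subtype

/-- The anchor `α : 𝔇(TM)_m → T_m M`. -/
def gaugeAnchor (m : M) : Gauge E m →ₗ[ℝ] Tang E m :=
  (LinearMap.snd ℝ _ _).comp (gaugeFiber m).subtype

lemma gaugeOp_fsmul {m : M} (d : Gauge E m) (f : SmoothFn E M) (u : VField E M) :
    gaugeOp m d (fsmul f u) = f m • gaugeOp m d u
      + mvfderiv 𝓘(ℝ, E) f m (gaugeAnchor m d) • u m := d.2 f u

lemma gauge_ext {m : M} {d d' : Gauge E m} (h : ∀ u, gaugeOp m d u = gaugeOp m d' u)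
    (h' : gaugeAnchor m d = gaugeAnchor m d') : d = d' :=
  Subtype.ext (Prod.ext (LinearMap.ext h) h')

/-- The inclusion `𝕚 : 𝔤𝔩(T_m M) → 𝔇(TM)_m`, sending `Φ` to `u ↦ Φ(u(m))`, with anchor zero. -/
def gaugeEmbed (m : M) : (Tang E m →L[ℝ] Tang E m) →ₗ[ℝ] Gauge E m where
  toFun Φ := ⟨({ toFun := fun u => Φ (u m)
                 map_add' := by intro u v; simp
                 map_smul' := by intro c u; simp }, 0), by intro f u; simp⟩
  map_add' := by
    intro a b
    apply Subtype.ext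
    refine Prod.ext ?_ ?_
    · ext u; rfl
    · simp
  map_smul' := by
    intro c a
    apply Subtype.ext
    refine Prod.ext ?_ ?_
    · ext u; rfl
    · simp

/-- `Γ(𝔇(TM))`: a section is smooth when it carries smooth vector fields to smooth vector fields
and its anchor is a smooth vector field. -/
def gaugeSections : Submodule ℝ (∀ m : M, Gauge E m) where
  carrier := {d | (∀ u : VField E M, ContMDiff 𝓘(ℝ, E) 𝓘(ℝ, E).tangent ∞
      (fun m => (⟨m, gaugeOp m (d m) u⟩ : TangentBundle 𝓘(ℝ, E) M))) ∧
    ContMDiff 𝓘(ℝ, E) 𝓘(ℝ, E).tangent ∞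
      (fun m => (⟨m, gaugeAnchor m (d m)⟩ : TangentBundle 𝓘(ℝ, E) M))}
  add_mem' := by
    intro a b ha hb
    refine ⟨fun u => ?_, ?_⟩
    · simpa using! (ha.1 u).add_section (hb.1 u)
    · simpa using! ha.2.add_section hb.2
  zero_mem' := by
    refine ⟨fun u => ?_, ?_⟩
    · simpa using! (0 : VField E M).contMDiff
    · simpa using! (0 : VField E M).contMDiff
  smul_mem' := by
    intro c a ha
    refine ⟨fun u => ?_, ?_⟩
    · simpa using! (ha.1 u).const_smul_section (a := c)
    · simpa using! ha.2.const_smul_section (a := c)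

variable (E M) in
/-- The type `Γ(𝔇(TM))`. -/
abbrev GaugeSec : Type _ := ↥(gaugeSections (E := E) (M := M))

instance : AddCommGroup (GaugeSec E M) := inferInstance
instance : AddCommMonoid (GaugeSec E M) := inferInstance
instance : AddGroup (GaugeSec E M) := inferInstance
instance : AddMonoid (GaugeSec E M) := inferInstance
instance : AddZeroClass (GaugeSec E M) := inferInstance
instance : Module ℝ (GaugeSec E M) := inferInstance

/-- The action of a smooth section of `𝔇(TM)` on a smooth vector field. -/
def gact (d : GaugeSec E M) (u : VField E M) : VField E M :=
  ⟨fun m => gaugeOp m (d.1 m) u, d.2.1 u⟩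

/-- The anchor of a smooth section of `𝔇(TM)`, as a smooth vector field. -/
def ganchor (d : GaugeSec E M) : VField E M := ⟨fun m => gaugeAnchor m (d.1 m), d.2.2⟩

lemma gact_apply (d : GaugeSec E M) (u : VField E M) (m : M) :
    gact d u m = gaugeOp m (d.1 m) u := rfl

lemma ganchor_apply (d : GaugeSec E M) (m : M) : ganchor d m = gaugeAnchor m (d.1 m) := rfl

lemma gact_fsmul (d : GaugeSec E M) (f : SmoothFn E M) (u : VField E M) :
    gact d (fsmul f u) = fsmul f (gact d u) + fsmul (dir (ganchor d) f) u := by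
  ext m
  exact gaugeOp_fsmul _ _ _

variable [FiniteDimensional ℝ E]

/-- The bracket of `Γ(𝔇(TM))`: the commutator of operators. -/
def gaugeBracket (d d' : GaugeSec E M) : GaugeSec E M :=
  ⟨fun m => ⟨({ toFun := fun u => gaugeOp m (d.1 m) (gact d' u) - gaugeOp m (d'.1 m) (gact d u)
                map_add' := by
                  intro u v
                  have h : ∀ e : GaugeSec E M, gact e (u + v) = gact e u + gact e v := by
                    intro e; ext p; simp [gact_apply]
                  simp only [h, map_add]; abel
                map_smul' := by
                  intro c u
                  have h : ∀ e : GaugeSec E M, gact e (c • u) = c • gact e u := by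
                    intro e; ext p; simp [gact_apply]
                  simp only [h, map_smul, RingHom.id_apply, smul_sub] },
              vbracket (ganchor d) (ganchor d') m), by
      intro f u
      have key := dir_vbracket_smul (ganchor d) (ganchor d') u f m
      rw [dir_apply] at key
      simp only [LinearMap.coe_mk, AddHom.coe_mk]
      rw [key, gact_fsmul, gact_fsmul, map_add, map_add]
      simp only [gaugeOp_fsmul, gact_apply]
      simp only [← ganchor_apply, ← dir_apply, smul_sub, sub_smul]
      abel⟩, by
    refine ⟨fun u => ?_, (vbracket (ganchor d) (ganchor d')).contMDiff⟩
    exact (gact d (gact d' u) - gact d' (gact d u)).contMDiff⟩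

lemma gact_gaugeBracket (d d' : GaugeSec E M) (u : VField E M) :
    gact (gaugeBracket d d') u = gact d (gact d' u) - gact d' (gact d u) := rfl

lemma ganchor_gaugeBracket (d d' : GaugeSec E M) :
    ganchor (gaugeBracket d d') = vbracket (ganchor d) (ganchor d') := rfl

/-- The element `[u, ·](m)` of `𝔇(TM)_m`, with anchor `u(m)`, linearly in `u`. -/
def adAt (m : M) : VField E M →ₗ[ℝ] Gauge E m where
  toFun u := ⟨({ toFun := fun v => vbracket u v m
                 map_add' := by intro v w; rw [vbracket_add_right]; rfl
                 map_smul' := by intro c v; rw [vbracket_smul_right]; rfl }, u m), by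
      intro f v
      simp only [LinearMap.coe_mk, AddHom.coe_mk, vbracket_fsmul_right]
      rfl⟩
  map_add' := by
    intro u v
    refine gauge_ext (fun w => ?_) rfl
    exact congrArg (fun s : VField E M => s m) (vbracket_add_left u v w)
  map_smul' := by
    intro c v
    refine gauge_ext (fun w => ?_) rfl
    exact congrArg (fun s : VField E M => s m) (vbracket_smul_left c v w)

lemma gaugeOp_adAt (m : M) (u v : VField E M) : gaugeOp m (adAt m u) v = vbracket u v m := rfl

lemma gaugeAnchor_adAt (m : M) (u : VField E M) : gaugeAnchor m (adAt m u) = u m := rfl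

/-- The derivation `[u, ·]` of `TM`, as a smooth section of `𝔇(TM)`. -/
def ad (u : VField E M) : GaugeSec E M :=
  ⟨fun m => adAt m u, fun v => (vbracket u v).contMDiff, u.contMDiff⟩

lemma ad_apply (u : VField E M) (m : M) : (ad u).1 m = adAt m u := rfl

end Gauge

end Basics


section Frames

variable {E : Type*} [NormedAddCommGroup E] [NormedSpace ℝ E] [FiniteDimensional ℝ E]
  {M : Type*} [TopologicalSpace M] [ChartedSpace E M] [IsManifold 𝓘(ℝ, E) ∞ M] [T2Space M]

variable (E) in
/-- A smooth bump function at `m`, equal to `1` near `m` and supported in the preferred chart. -/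
def bump (m : M) : SmoothBumpFunction 𝓘(ℝ, E) m := Classical.arbitrary _

variable (E) in
/-- The bump function at `m` as a smooth function on `M`. -/
def bumpFn (m : M) : SmoothFn E M := ⟨bump E m, (bump E m).contMDiff⟩

@[simp] lemma bumpFn_self (m : M) : bumpFn E m m = 1 := (bump E m).eq_one

variable (E) in
/-- The trivialization of `TM` over the preferred chart at `m`. -/
abbrev triv (m : M) : Trivialization E (TotalSpace.proj : TangentBundle 𝓘(ℝ, E) M → M) :=
  trivializationAt E (fun p : M => Tang E p) m

lemma tsupport_bump (m : M) : tsupport (bump E m) ⊆ (triv E m).baseSet := by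
  rw [TangentBundle.trivializationAt_baseSet]
  exact (bump E m).tsupport_subset_chartAt_source

lemma bumpFn_eq_zero {m p : M} (hp : p ∉ (triv E m).baseSet) : bumpFn E m p = 0 :=
  image_eq_zero_of_notMem_tsupport fun h => hp (tsupport_bump m h)

/-- The vector field which near `m` is the `i`-th coordinate vector field of the preferred chart
at `m` (with respect to a basis of `E`), cut off outside of that chart. -/
def frame (m : M) (i : Fin (Module.finrank ℝ E)) : VField E M :=
  ⟨(bump E m : M → ℝ) • fun p => (triv E m).symm p (Module.finBasis ℝ E i), by
    refine ContMDiffOn.smul_section_of_tsupport (bump E m).contMDiff.contMDiffOn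
      (triv E m).open_baseSet (tsupport_bump m) ?_
    rw [(triv E m).contMDiffOn_section_baseSet_iff]
    refine (contMDiffOn_const (c := Module.finBasis ℝ E i)).congr ?_
    intro y hy
    rw [Trivialization.apply_mk_symm _ hy]⟩

lemma frame_apply (m p : M) (i : Fin (Module.finrank ℝ E)) :
    frame m i p = bumpFn E m p • (triv E m).symm p (Module.finBasis ℝ E i) := rfl

variable (E) in
/-- The coordinate basis of `T_m M` in the preferred chart at `m`. -/
def tbasis (m : M) : Module.Basis (Fin (Module.finrank ℝ E)) ℝ (Tang E m) := Module.finBasis ℝ E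

@[simp] lemma frame_self (m : M) (i : Fin (Module.finrank ℝ E)) :
    frame m i m = tbasis E m i := by
  rw [frame_apply, bumpFn_self, one_smul]
  have h := TangentBundle.symmL_trivializationAt (I := 𝓘(ℝ, E)) (𝕜 := ℝ) (mem_chart_source E m)
  rw [mfderivWithin_range_extChartAt_symm] at h
  refine ((triv E m).symmL_apply (R := ℝ) (mem_baseSet_trivializationAt E _ m) _).symm.trans ?_
  exact congrArg (fun L : E →L[ℝ] Tang E m => L (Module.finBasis ℝ E i)) h

/-- The coordinate covectors dual to `frame`, cut off outside of the preferred chart at `m`. -/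
def coframe (m : M) (i : Fin (Module.finrank ℝ E)) : OneForm E M :=
  ⟨(bump E m : M → ℝ) • fun p => ((Module.finBasis ℝ E).coord i).toContinuousLinearMap ∘L
      (triv E m).continuousLinearMapAt ℝ p, by
    refine ContMDiffOn.smul_section_of_tsupport (bump E m).contMDiff.contMDiffOn
      (triv E m).open_baseSet (tsupport_bump m) ?_
    intro x hx
    refine ContMDiffAt.contMDiffWithinAt ?_
    rw [contMDiffAt_hom_bundle]
    refine ⟨contMDiffAt_id, ?_⟩
    have hx' : x ∈ (triv E x).baseSet := mem_baseSet_trivializationAt E _ x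
    have hc := contMDiffAt_coordChangeL (IB := 𝓘(ℝ, E)) (n := ∞) (e := triv E x) (e' := triv E m)
      hx' hx
    have h2 : ContMDiffAt 𝓘(ℝ, E) 𝓘(ℝ, E →L[ℝ] ℝ) ∞ (fun p =>
        ((Module.finBasis ℝ E).coord i).toContinuousLinearMap ∘L
        ((triv E x).coordChangeL ℝ (triv E m) p : E →L[ℝ] E)) x :=
      contMDiffAt_const.clm_comp hc
    refine h2.congr_of_eventuallyEq ?_
    filter_upwards [(triv E x).open_baseSet.mem_nhds hx', (triv E m).open_baseSet.mem_nhds hx]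
      with p hp hp'
    ext v
    simp [ContinuousLinearMap.inCoordinates, Trivialization.coordChangeL_apply' _ _ ⟨hp, hp'⟩,
      Trivialization.coe_linearMapAt_of_mem _ hp', (triv E x).symmL_apply hp,
      (triv E x).mk_symm hp]⟩

lemma coframe_apply (m p : M) (i : Fin (Module.finrank ℝ E)) (v : Tang E p) :
    coframe m i p v = bumpFn E m p *
      (Module.finBasis ℝ E).repr ((triv E m).continuousLinearMapAt ℝ p v) i := rfl

lemma sum_coframe (m p : M) (v : Tang E p) :
    ∑ i, coframe m i p v • frame m i p = (bumpFn E m p * bumpFn E m p) • v := by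
  by_cases hp : p ∈ (triv E m).baseSet
  · simp only [coframe_apply, frame_apply, smul_smul]
    have h1 : ∀ i, (triv E m).symm p (Module.finBasis ℝ E i)
        = (triv E m).symmL ℝ p (Module.finBasis ℝ E i) := fun i => ((triv E m).symmL_apply hp _).symm
    calc _ = ∑ i, (bumpFn E m p * bumpFn E m p) • (triv E m).symmL ℝ p
          (((Module.finBasis ℝ E).repr ((triv E m).continuousLinearMapAt ℝ p v) i) •
            Module.finBasis ℝ E i) := by
          refine Finset.sum_congr rfl fun i _ => ?_
          rw [h1, map_smul, smul_smul]
          congr 1; ring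
      _ = _ := by
          rw [← Finset.smul_sum, ← map_sum, Module.Basis.sum_repr,
            Trivialization.symmL_continuousLinearMapAt _ hp]
  · simp [frame_apply, bumpFn_eq_zero hp]


/-- The `i`-th coordinate of the preferred chart at `m`, vanishing at `m` and cut off outside of
the chart. -/
def coordFn (m : M) (i : Fin (Module.finrank ℝ E)) : SmoothFn E M :=
  ⟨fun p => bump E m p • ((Module.finBasis ℝ E).coord i).toContinuousLinearMap
      (extChartAt 𝓘(ℝ, E) m p - extChartAt 𝓘(ℝ, E) m m), by
    refine (bump E m).contMDiff_smul ?_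
    refine ContMDiffOn.clm_apply contMDiffOn_const ?_
    exact (contMDiffOn_extChartAt (I := 𝓘(ℝ, E)) (n := ∞)).sub contMDiffOn_const⟩

@[simp] lemma coordFn_self (m : M) (i : Fin (Module.finrank ℝ E)) : coordFn (E := E) m i m = 0 := by
  simp [coordFn]

lemma mvfderiv_coordFn (m : M) (i : Fin (Module.finrank ℝ E)) (v : Tang E m) :
    mvfderiv 𝓘(ℝ, E) (coordFn (E := E) m i) m v = (tbasis E m).repr v i := by
  set L : E →L[ℝ] ℝ := ((Module.finBasis ℝ E).coord i).toContinuousLinearMap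
  have h1 : HasMFDerivAt 𝓘(ℝ, E) 𝓘(ℝ, E) (extChartAt 𝓘(ℝ, E) m) m
      (ContinuousLinearMap.id ℝ (Tang E m)) := by
    have := (mdifferentiableAt_extChartAt (I := 𝓘(ℝ, E)) (mem_chart_source E m)).hasMFDerivAt
    rwa [mfderiv_extChartAt_self] at this
  have h2 : HasMFDerivAt 𝓘(ℝ, E) 𝓘(ℝ, ℝ)
      (fun p => L (extChartAt 𝓘(ℝ, E) m p - extChartAt 𝓘(ℝ, E) m m)) m L := by
    have hL : HasMFDerivAt 𝓘(ℝ, E) 𝓘(ℝ, ℝ)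
        (fun x : E => L (x - extChartAt 𝓘(ℝ, E) m m)) (extChartAt 𝓘(ℝ, E) m m) L := by
      apply HasFDerivAt.hasMFDerivAt
      exact L.hasFDerivAt.comp _ ((hasFDerivAt_id _).sub_const _)
    exact hL.comp m h1
  have h3 : HasMFDerivAt 𝓘(ℝ, E) 𝓘(ℝ, ℝ) (coordFn (E := E) m i) m L := by
    refine h2.congr_of_eventuallyEq ?_
    filter_upwards [(bump E m).eventuallyEq_one] with p hp
    change bump E m p • L (extChartAt 𝓘(ℝ, E) m p - extChartAt 𝓘(ℝ, E) m m) = _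
    rw [hp]; exact one_smul ℝ _
  rw [mvfderiv, h3.mfderiv]
  rfl

end Frames

section Jets

variable {E : Type*} [NormedAddCommGroup E] [NormedSpace ℝ E]
  {M : Type*} [TopologicalSpace M] [ChartedSpace E M] [IsManifold 𝓘(ℝ, E) ∞ M]

lemma contract_add (ξ : OneForm E M) (u v : VField E M) :
    contract ξ (u + v) = contract ξ u + contract ξ v := by
  ext m; simp [contract_apply]

lemma contract_smul (ξ : OneForm E M) (c : ℝ) (u : VField E M) :
    contract ξ (c • u) = c • contract ξ u := by
  ext m; simp [contract_apply]

lemma mvfderiv_fn_add (f g : SmoothFn E M) (m : M) :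
    mvfderiv 𝓘(ℝ, E) (f + g : SmoothFn E M) m
      = mvfderiv 𝓘(ℝ, E) f m + mvfderiv 𝓘(ℝ, E) g m :=
  mvfderiv_add (mdiff_fn f m) (mdiff_fn g m)

lemma mvfderiv_fn_smul (c : ℝ) (f : SmoothFn E M) (m : M) :
    mvfderiv 𝓘(ℝ, E) (c • f : SmoothFn E M) m = c • mvfderiv 𝓘(ℝ, E) f m := by
  have h := mvfderiv_smul (I := 𝓘(ℝ, E)) (mdifferentiableAt_const (c := c)) (mdiff_fn f m)
  ext v
  have h' := congrArg (fun L : Tang E m →L[ℝ] ℝ => L v) h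
  simpa [mvfderiv_const] using! h'

/-- The vector fields `u` with `u(m) = 0` and `d⟨u, ξ⟩_m = 0` for every one-form `ξ`. -/
def jetNull (m : M) : Submodule ℝ (VField E M) where
  carrier := {u | u m = 0 ∧ ∀ ξ : OneForm E M, mvfderiv 𝓘(ℝ, E) (contract ξ u) m = 0}
  add_mem' := by
    rintro u v ⟨hu, hu'⟩ ⟨hv, hv'⟩
    refine ⟨by simp [hu, hv], fun ξ => ?_⟩
    rw [contract_add, mvfderiv_fn_add, hu', hv', add_zero]
  zero_mem' := by
    refine ⟨rfl, fun ξ => ?_⟩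
    have : contract ξ (0 : VField E M) = (0 : ℝ) • contract ξ 0 := by
      rw [← contract_smul, zero_smul]
    rw [this, mvfderiv_fn_smul, zero_smul]
  smul_mem' := by
    rintro c u ⟨hu, hu'⟩
    refine ⟨by simp [hu], fun ξ => ?_⟩
    rw [contract_smul, mvfderiv_fn_smul, hu', smul_zero]

variable (E) in
/-- The fibre `𝔍(TM)_m` of the first jet bundle of `TM`: smooth vector fields modulo the relation
of having the same value at `m` and the same `d⟨·, ξ⟩_m` for every one-form `ξ`. -/
abbrev Jet (m : M) : Type _ := VField E M ⧸ jetNull (E := E) m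

instance (m : M) : AddCommGroup (Jet E m) := inferInstance
instance (m : M) : AddCommMonoid (Jet E m) := inferInstance
instance (m : M) : AddGroup (Jet E m) := inferInstance
instance (m : M) : AddMonoid (Jet E m) := inferInstance
instance (m : M) : AddZeroClass (Jet E m) := inferInstance
instance (m : M) : Module ℝ (Jet E m) := inferInstance

/-- The first jet `[u]_m` of a vector field. -/
def jet (m : M) : VField E M →ₗ[ℝ] Jet E m := (jetNull m).mkQ

lemma jet_eq_iff (m : M) (u v : VField E M) :
    jet m u = jet m v ↔ u m = v m ∧ ∀ ξ : OneForm E M,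
      mvfderiv 𝓘(ℝ, E) (contract ξ u) m = mvfderiv 𝓘(ℝ, E) (contract ξ v) m := by
  have h : u - v ∈ jetNull m ↔ (u - v) m = 0 ∧
      ∀ ξ : OneForm E M, mvfderiv 𝓘(ℝ, E) (contract ξ (u - v)) m = 0 := Iff.rfl
  have h2 : u - v = u + (-1 : ℝ) • v := by simp [sub_eq_add_neg]
  rw [jet, Submodule.mkQ_apply, Submodule.mkQ_apply, Submodule.Quotient.eq, h]
  refine and_congr (by simp [sub_eq_zero]) (forall_congr' fun ξ => ?_)
  rw [h2, contract_add, contract_smul, mvfderiv_fn_add, mvfderiv_fn_smul, neg_one_smul,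
    ← sub_eq_add_neg, sub_eq_zero]

lemma jet_induction {m : M} {P : Jet E m → Prop} (h : ∀ u, P (jet m u)) (μ : Jet E m) : P μ :=
  Submodule.Quotient.induction_on _ μ h

/-- The projection `𝕡 : 𝔍(TM)_m → T_m M`, `[u]_m ↦ u(m)`. -/
def jetProj (m : M) : Jet E m →ₗ[ℝ] Tang E m :=
  (jetNull m).liftQ { toFun := fun u => u m, map_add' := fun _ _ => rfl, map_smul' := fun _ _ => rfl }
    (fun _ hu => hu.1)

@[simp] lemma jetProj_jet (m : M) (u : VField E M) : jetProj m (jet m u) = u m := rfl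

variable [FiniteDimensional ℝ E] [T2Space M]

lemma sum_coframe_fsmul (m : M) (u : VField E M) :
    fsmul (bumpFn E m * bumpFn E m) u = ∑ i, fsmul (contract (coframe m i) u) (frame m i) := by
  ext p
  have : ∀ (s : Finset (Fin (Module.finrank ℝ E))) (w : Fin (Module.finrank ℝ E) → VField E M),
      (∑ i ∈ s, w i) p = ∑ i ∈ s, w i p := by
    intro s w
    exact map_sum ({ toFun := fun u => u p, map_zero' := rfl, map_add' := fun _ _ => rfl } :
      VField E M →+ Tang E p) w s
  rw [this]
  exact (sum_coframe m p (u p)).symm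

lemma gaugeOp_eq_zero {m : M} (d : Gauge E m) {u : VField E M} (hu : u ∈ jetNull m) :
    gaugeOp m d u = 0 := by
  have h1 := gaugeOp_fsmul d (bumpFn E m * bumpFn E m) u
  rw [sum_coframe_fsmul, map_sum, hu.1, smul_zero, add_zero] at h1
  have h2 : (bumpFn E m * bumpFn E m) m = 1 := by
    change bumpFn E m m * bumpFn E m m = 1; simp
  rw [h2, one_smul] at h1
  rw [← h1]
  refine Finset.sum_eq_zero fun i _ => ?_
  rw [gaugeOp_fsmul, hu.2, contract_apply, hu.1, map_zero]
  have h3 : (0 : Tang E m →L[ℝ] ℝ) (gaugeAnchor m d) = 0 := rfl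
  have h4 : ∀ a b : Tang E m, (0 : ℝ) • a + (0 : ℝ) • b = 0 := fun a b => by simp
  rw [h3]
  exact h4 _ _

lemma gaugeOp_eq_zero_of_anchor {m : M} (d : Gauge E m) (hd : gaugeAnchor m d = 0)
    {u : VField E M} (hu : u m = 0) : gaugeOp m d u = 0 := by
  have h1 := gaugeOp_fsmul d (bumpFn E m * bumpFn E m) u
  rw [sum_coframe_fsmul, map_sum, hu, smul_zero, add_zero] at h1
  have h2 : (bumpFn E m * bumpFn E m) m = 1 := by
    change bumpFn E m m * bumpFn E m m = 1; simp
  rw [h2, one_smul] at h1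
  rw [← h1]
  refine Finset.sum_eq_zero fun i _ => ?_
  rw [gaugeOp_fsmul, hd, contract_apply, hu, map_zero, map_zero]
  have h4 : ∀ a b : Tang E m, (0 : ℝ) • a + (0 : ℝ) • b = 0 := fun a b => by simp
  exact h4 _ _

/-- The `TM`-valued pairing between `𝔍(TM)_m` and `𝔇(TM)_m`: `⟨[u]_m, d⟩ = d(u)`. -/
def pairing (m : M) : Jet E m →ₗ[ℝ] Gauge E m →ₗ[ℝ] Tang E m :=
  (jetNull m).liftQ (gaugeOp m).flip (fun _ hu => LinearMap.ext fun d => gaugeOp_eq_zero d hu)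

@[simp] lemma pairing_jet (m : M) (u : VField E M) (d : Gauge E m) :
    pairing m (jet m u) d = gaugeOp m d u := rfl

/-- The bundle map `π : 𝔍(TM) → 𝔇(TM)` attached to the Lie algebroid `TM`, determined by
`π([u]_m) = [u, ·](m)`. -/
def jetToGauge (m : M) : Jet E m →ₗ[ℝ] Gauge E m :=
  (jetNull m).liftQ (adAt m) (fun u hu => gauge_ext (fun v => by
    change vbracket u v m = 0
    rw [vbracket_swap]
    change - gaugeOp m (adAt m v) u = 0
    rw [gaugeOp_eq_zero _ hu, neg_zero]) hu.1)

@[simp] lemma jetToGauge_jet (m : M) (u : VField E M) : jetToGauge m (jet m u) = adAt m u := rfl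

lemma gaugeOp_jetToGauge (m : M) (μ : Jet E m) (v : VField E M) :
    gaugeOp m (jetToGauge m μ) v = - pairing m μ (adAt m v) := by
  induction μ using jet_induction with
  | h u =>
    rw [jetToGauge_jet, pairing_jet, gaugeOp_adAt, gaugeOp_adAt, vbracket_swap]; rfl

lemma gaugeAnchor_jetToGauge (m : M) (μ : Jet E m) :
    gaugeAnchor m (jetToGauge m μ) = jetProj m μ := by
  induction μ using jet_induction with
  | h u => rfl

lemma pairing_gaugeEmbed (m : M) (μ : Jet E m) (Φ : Tang E m →L[ℝ] Tang E m) :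
    pairing m μ (gaugeEmbed m Φ) = Φ (jetProj m μ) := by
  induction μ using jet_induction with
  | h u => rfl

/-- The inclusion `𝕖 : Hom(T_m M, T_m M) → 𝔍(TM)_m`: `𝕖(y)` is the jet at `m` of a vector field
which, in the preferred chart at `m` and near `m`, is `p ↦ y(p - m)`. -/
def jetEmbed (m : M) : (Tang E m →L[ℝ] Tang E m) →ₗ[ℝ] Jet E m where
  toFun y := jet m (∑ i, ∑ j, (tbasis E m).repr (y (tbasis E m i)) j •
    fsmul (coordFn m i) (frame m j))
  map_add' := by
    intro y z
    rw [← map_add, ← Finset.sum_add_distrib]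
    congr 1
    refine Finset.sum_congr rfl fun i _ => ?_
    rw [← Finset.sum_add_distrib]
    refine Finset.sum_congr rfl fun j _ => ?_
    rw [← add_smul]
    congr 1
    simp
  map_smul' := by
    intro c y
    rw [RingHom.id_apply, ← map_smul, Finset.smul_sum]
    congr 1
    refine Finset.sum_congr rfl fun i _ => ?_
    rw [Finset.smul_sum]
    refine Finset.sum_congr rfl fun j _ => ?_
    rw [smul_smul]
    congr 1
    simp

/-- `⟨𝕖(y), d⟩ = y(α(d))`. -/
lemma pairing_jetEmbed (m : M) (y : Tang E m →L[ℝ] Tang E m) (d : Gauge E m) :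
    pairing m (jetEmbed m y) d = y (gaugeAnchor m d) := by
  change gaugeOp m d _ = _
  rw [map_sum]
  have h0 : ∀ i : Fin (Module.finrank ℝ E), gaugeOp m d (∑ j,
      (tbasis E m).repr (y (tbasis E m i)) j • fsmul (coordFn m i) (frame m j))
      = (tbasis E m).repr (gaugeAnchor m d) i • y (tbasis E m i) := by
    intro i
    rw [map_sum]
    have h1 : ∀ j : Fin (Module.finrank ℝ E), gaugeOp m d
        ((tbasis E m).repr (y (tbasis E m i)) j •
          fsmul (coordFn m i) (frame m j))
        = (tbasis E m).repr (gaugeAnchor m d) i •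
          ((tbasis E m).repr (y (tbasis E m i)) j •
            tbasis E m j) := by
      intro j
      rw [map_smul, gaugeOp_fsmul, coordFn_self, zero_smul, zero_add, mvfderiv_coordFn, frame_self,
        smul_comm]
    rw [Finset.sum_congr rfl fun j _ => h1 j, ← Finset.smul_sum]
    congr 1
    exact (tbasis E m).sum_repr (y (tbasis E m i) )
  rw [Finset.sum_congr rfl fun i _ => h0 i]
  have h2 : gaugeAnchor m d = ∑ i, (tbasis E m).repr (gaugeAnchor m d) i •
      tbasis E m i :=
    ((tbasis E m).sum_repr (gaugeAnchor m d )).symm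
  conv_rhs => rw [h2]
  rw [map_sum]
  exact Finset.sum_congr rfl fun i _ => (map_smul y _ _).symm

end Jets

section JetSections

variable {E : Type*} [NormedAddCommGroup E] [NormedSpace ℝ E] [FiniteDimensional ℝ E]
  {M : Type*} [TopologicalSpace M] [ChartedSpace E M] [IsManifold 𝓘(ℝ, E) ∞ M] [T2Space M]

/-- `Γ(𝔍(TM))`: a section is smooth when its pairing with every smooth section of `𝔇(TM)` is a
smooth vector field. -/
def jetSections : Submodule ℝ (∀ m : M, Jet E m) where
  carrier := {μ | ∀ d : GaugeSec E M, ContMDiff 𝓘(ℝ, E) 𝓘(ℝ, E).tangent ∞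
    (fun m => (⟨m, pairing m (μ m) (d.1 m)⟩ : TangentBundle 𝓘(ℝ, E) M))}
  add_mem' := by
    intro a b ha hb d
    simpa using! (ha d).add_section (hb d)
  zero_mem' := by
    intro d
    simpa using! (0 : VField E M).contMDiff
  smul_mem' := by
    intro c a ha d
    simpa using! (ha d).const_smul_section (a := c)

variable (E M) in
/-- The type `Γ(𝔍(TM))`. -/
abbrev JetSec : Type _ := ↥(jetSections (E := E) (M := M))

instance : AddCommGroup (JetSec E M) := inferInstance
instance : AddCommMonoid (JetSec E M) := inferInstance
instance : AddGroup (JetSec E M) := inferInstance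
instance : AddMonoid (JetSec E M) := inferInstance
instance : AddZeroClass (JetSec E M) := inferInstance
instance : Module ℝ (JetSec E M) := inferInstance

/-- The pairing of a smooth section of `𝔍(TM)` with a smooth section of `𝔇(TM)`. -/
def pairSec (μ : JetSec E M) (d : GaugeSec E M) : VField E M :=
  ⟨fun m => pairing m (μ.1 m) (d.1 m), μ.2 d⟩

lemma pairSec_apply (μ : JetSec E M) (d : GaugeSec E M) (m : M) :
    pairSec μ d m = pairing m (μ.1 m) (d.1 m) := rfl

/-- The prolongation `𝕕u : m ↦ [u]_m` of a vector field. -/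
def prolong (u : VField E M) : JetSec E M := ⟨fun m => jet m u, fun d => (gact d u).contMDiff⟩

lemma pairSec_prolong (u : VField E M) (d : GaugeSec E M) : pairSec (prolong u) d = gact d u := rfl

/-- The identity operator of `TM`, as a smooth section of `𝔇(TM)`. -/
def gaugeOne : GaugeSec E M :=
  ⟨fun m => gaugeEmbed m (ContinuousLinearMap.id ℝ _),
    fun u => u.contMDiff, (0 : VField E M).contMDiff⟩

/-- The product of a smooth function and a smooth section of `𝔇(TM)`. -/
def gsmul (f : SmoothFn E M) (d : GaugeSec E M) : GaugeSec E M :=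
  ⟨fun m => f m • d.1 m, fun u => by simpa using! (fsmul f (gact d u)).contMDiff,
    by simpa using! (fsmul f (ganchor d)).contMDiff⟩

lemma gact_gsmul (f : SmoothFn E M) (d : GaugeSec E M) (u : VField E M) :
    gact (gsmul f d) u = fsmul f (gact d u) := by
  ext m; simp [gact_apply, gsmul]

lemma ganchor_gsmul (f : SmoothFn E M) (d : GaugeSec E M) :
    ganchor (gsmul f d) = fsmul f (ganchor d) := by
  ext m; simp [ganchor_apply, gsmul]

lemma gact_add (d d' : GaugeSec E M) (u : VField E M) : gact (d + d') u = gact d u + gact d' u := by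
  ext m; simp [gact_apply]

lemma gact_sub (d d' : GaugeSec E M) (u : VField E M) : gact (d - d') u = gact d u - gact d' u := by
  ext m; simp [gact_apply]

lemma gact_map_add (d : GaugeSec E M) (u v : VField E M) : gact d (u + v) = gact d u + gact d v := by
  ext m; simp [gact_apply]

lemma gact_map_sub (d : GaugeSec E M) (u v : VField E M) : gact d (u - v) = gact d u - gact d v := by
  ext m; simp [gact_apply]

lemma ganchor_add (d d' : GaugeSec E M) : ganchor (d + d') = ganchor d + ganchor d' := by
  ext m; simp [ganchor_apply]

lemma ganchor_sub (d d' : GaugeSec E M) : ganchor (d - d') = ganchor d - ganchor d' := by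
  ext m; simp [ganchor_apply]

lemma gsec_ext {d d' : GaugeSec E M} (h : ∀ u, gact d u = gact d' u)
    (h' : ganchor d = ganchor d') : d = d' := by
  apply Subtype.ext
  funext m
  refine gauge_ext (fun u => ?_) ?_
  · exact congrArg (fun s : VField E M => s m) (h u)
  · exact congrArg (fun s : VField E M => s m) h'

lemma gact_ad (u v : VField E M) : gact (ad u) v = vbracket u v := rfl

lemma ganchor_ad (u : VField E M) : ganchor (ad u) = u := rfl

lemma field_sum_apply (s : Finset (Fin (Module.finrank ℝ E)))
    (w : Fin (Module.finrank ℝ E) → VField E M) (p : M) : (∑ i ∈ s, w i) p = ∑ i ∈ s, w i p :=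
  map_sum ({ toFun := fun u => u p, map_zero' := rfl, map_add' := fun _ _ => rfl } :
    VField E M →+ Tang E p) w s

/-- Every `C^∞(M)`-linear map `R : Γ(𝔇(TM)) → Γ(TM)` with `R(Φ) = Φ(R(1))` for `Φ` in
`Γ(𝔤𝔩(TM))` is the pairing with a smooth section of `𝔍(TM)`. -/
lemma exists_jetSec (R : GaugeSec E M →+ VField E M)
    (hsmul : ∀ f d, R (gsmul f d) = fsmul f (R d))
    (hgl : ∀ d, ganchor d = 0 → R d = gact d (R gaugeOne)) :
    ∃ μ : JetSec E M, ∀ d, pairSec μ d = R d := by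
  have hR : ∀ d, R d = gact d (R gaugeOne) + (R (ad (ganchor d)) -
      gact (ad (ganchor d)) (R gaugeOne)) := by
    intro d
    have h := hgl (d - ad (ganchor d)) (by rw [ganchor_sub, ganchor_ad, sub_self])
    rw [R.map_sub, gact_sub] at h
    rw [sub_eq_sub_iff_add_eq_add] at h
    rw [add_sub, ← h]; abel
  set S : VField E M →+ VField E M :=
    { toFun := fun x => R (ad x) - gact (ad x) (R gaugeOne)
      map_zero' := by
        have h : ad (0 : VField E M) = 0 := by
          apply Subtype.ext; funext m; exact map_zero (adAt m)
        rw [h, map_zero]; ext m; simp [gact_apply]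
      map_add' := by
        intro x y
        have h : ad (x + y) = ad x + ad y := by
          apply Subtype.ext; funext m; exact map_add (adAt m) x y
        rw [h, map_add, gact_add]; abel } with hS
  have hSf : ∀ f x, S (fsmul f x) = fsmul f (S x) := by
    intro f x
    have h := hgl (ad (fsmul f x) - gsmul f (ad x)) (by
      rw [ganchor_sub, ganchor_gsmul, ganchor_ad, ganchor_ad, sub_self])
    rw [R.map_sub, gact_sub, hsmul, gact_gsmul] at h
    change R (ad (fsmul f x)) - gact (ad (fsmul f x)) (R gaugeOne)
      = fsmul f (R (ad x) - gact (ad x) (R gaugeOne))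
    have h3 : fsmul f (R (ad x) - gact (ad x) (R gaugeOne))
        = fsmul f (R (ad x)) - fsmul f (gact (ad x) (R gaugeOne)) := by
      ext m; simp [smul_sub]
    rw [h3, sub_eq_sub_iff_add_eq_add]
    rw [sub_eq_sub_iff_add_eq_add] at h
    rw [h]; abel
  have hpt : ∀ (x : VField E M) (m : M), S x m = ∑ i, coframe m i m (x m) • S (frame m i) m := by
    intro x m
    have h1 : S (fsmul (bumpFn E m * bumpFn E m) x) m = S x m := by
      rw [hSf]
      change (bumpFn E m m * bumpFn E m m) • S x m = _
      simp
    rw [← h1, sum_coframe_fsmul, map_sum, field_sum_apply]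
    refine Finset.sum_congr rfl fun i _ => ?_
    rw [hSf]; rfl
  let y : ∀ m : M, Tang E m →L[ℝ] Tang E m := fun m =>
    ∑ i, ((coframe m i m : Tang E m →L[ℝ] ℝ)).smulRight (S (frame m i) m)
  have hy : ∀ (x : VField E M) (m : M), y m (x m) = S x m := by
    intro x m
    rw [hpt]
    simp only [y, sum_apply]
    rfl
  have hpair : ∀ (d : GaugeSec E M) (m : M),
      pairing m (jet m (R gaugeOne) + jetEmbed m (y m)) (d.1 m) = R d m := by
    intro d m
    rw [map_add, LinearMap.add_apply, pairing_jet, pairing_jetEmbed, ← ganchor_apply, hy, hR d]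
    rfl
  refine ⟨⟨fun m => jet m (R gaugeOne) + jetEmbed m (y m), fun d => ?_⟩, fun d => ?_⟩
  · simp only [hpair]; exact (R d).contMDiff
  · ext m; exact hpair d m

/-- The defining formula of the Lie derivative `𝔏_d μ` of a smooth section of `𝔍(TM)`:
`⟨𝔏_d μ, d'⟩ = d⟨μ, d'⟩ - ⟨μ, [d, d']⟩`. -/
lemma exists_lieDeriv (d : GaugeSec E M) (μ : JetSec E M) :
    ∃ κ : JetSec E M, ∀ d' : GaugeSec E M,
      pairSec κ d' = gact d (pairSec μ d') - pairSec μ (gaugeBracket d d') := by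
  have hb_add : ∀ d₁ d₂ : GaugeSec E M,
      gaugeBracket d (d₁ + d₂) = gaugeBracket d d₁ + gaugeBracket d d₂ := by
    intro d₁ d₂
    refine gsec_ext (fun u => ?_) ?_
    · simp only [gact_gaugeBracket, gact_add, gact_map_add]; abel
    · simp only [ganchor_gaugeBracket, ganchor_add, vbracket_add_right]
  have hp_add : ∀ d₁ d₂ : GaugeSec E M, pairSec μ (d₁ + d₂) = pairSec μ d₁ + pairSec μ d₂ := by
    intro d₁ d₂; ext m; simp [pairSec_apply]
  have hp_smul : ∀ f (d₁ : GaugeSec E M), pairSec μ (gsmul f d₁) = fsmul f (pairSec μ d₁) := by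
    intro f d₁; ext m; simp [pairSec_apply, gsmul]
  have hb_smul : ∀ f (d₁ : GaugeSec E M),
      gaugeBracket d (gsmul f d₁) = gsmul f (gaugeBracket d d₁) + gsmul (dir (ganchor d) f) d₁ := by
    intro f d₁
    refine gsec_ext (fun u => ?_) ?_
    · simp only [gact_gaugeBracket, gact_add, gact_gsmul, gact_fsmul]
      ext m; simp [smul_sub]; abel
    · simp only [ganchor_gaugeBracket, ganchor_add, ganchor_gsmul, vbracket_fsmul_right]
  have hp_gl : ∀ d₁ : GaugeSec E M, ganchor d₁ = 0 →
      pairSec μ d₁ = gact d₁ (pairSec μ gaugeOne) := by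
    intro d₁ h₁
    ext m
    have ha : gaugeAnchor m (d₁.1 m) = 0 := congrArg (fun s : VField E M => s m) h₁
    change pairing m (μ.1 m) (d₁.1 m) = gaugeOp m (d₁.1 m) (pairSec μ gaugeOne)
    have hone : pairSec μ gaugeOne m = jetProj m (μ.1 m) := pairing_gaugeEmbed m (μ.1 m) _
    generalize pairSec μ gaugeOne = w at hone
    generalize μ.1 m = μm at hone ⊢
    induction μm using jet_induction with
    | h u =>
      rw [pairing_jet, ← sub_eq_zero, ← map_sub]
      refine gaugeOp_eq_zero_of_anchor _ ha ?_
      change u m - w m = 0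
      rw [hone, jetProj_jet, sub_self]
  obtain ⟨κ, hκ⟩ := exists_jetSec
    ({ toFun := fun d' => gact d (pairSec μ d') - pairSec μ (gaugeBracket d d')
       map_zero' := by
        have h0 : ∀ X : GaugeSec E M, X + X = X → X = 0 := fun X h => by simpa using h
        have h1 : pairSec μ 0 = 0 := by ext m; simp [pairSec_apply]
        have h2 : gaugeBracket d 0 = 0 := h0 _ (by rw [← hb_add, add_zero])
        rw [h1, h2, h1]; ext m; simp [gact_apply]
       map_add' := by
        intro d₁ d₂
        rw [hb_add, hp_add, hp_add, gact_map_add]; abel } : GaugeSec E M →+ VField E M)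
    (by
      intro f d'
      simp only [AddMonoidHom.coe_mk, ZeroHom.coe_mk]
      rw [hp_smul, hb_smul, hp_add, hp_smul, hp_smul, gact_fsmul]
      ext m; simp [smul_sub])
    (by
      intro d' hd'
      simp only [AddMonoidHom.coe_mk, ZeroHom.coe_mk]
      have h1 : gaugeBracket d gaugeOne = 0 := by
        refine gsec_ext (fun u => ?_) ?_
        · rw [gact_gaugeBracket]
          have : ∀ v : VField E M, gact gaugeOne v = v := fun v => rfl
          rw [this, this, sub_self]; ext m; simp [gact_apply]
        · rw [ganchor_gaugeBracket]
          have : ganchor (gaugeOne : GaugeSec E M) = 0 := rfl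
          rw [this]
          have := vbracket_smul_right (ganchor d) 0 0
          rw [zero_smul, zero_smul] at this
          rw [this]; rfl
      have h2 : ganchor (gaugeBracket d d') = 0 := by
        rw [ganchor_gaugeBracket, hd']
        have := vbracket_smul_right (ganchor d) 0 0
        rwa [zero_smul, zero_smul] at this
      have h3 : pairSec μ (0 : GaugeSec E M) = 0 := by ext m; simp [pairSec_apply]
      rw [h1, h3, sub_zero, hp_gl d' hd', hp_gl _ h2, gact_gaugeBracket]
      abel)
  exact ⟨κ, hκ⟩

/-- The Lie derivative `𝔏_d μ` of a smooth section of `𝔍(TM)` along a smooth section of `𝔇(TM)`. -/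
def lieDeriv (d : GaugeSec E M) (μ : JetSec E M) : JetSec E M := (exists_lieDeriv d μ).choose

lemma pairSec_lieDeriv (d : GaugeSec E M) (μ : JetSec E M) (d' : GaugeSec E M) :
    pairSec (lieDeriv d μ) d' = gact d (pairSec μ d') - pairSec μ (gaugeBracket d d') :=
  (exists_lieDeriv d μ).choose_spec d'

/-- The map induced by `π` on smooth sections. -/
def jetPi (μ : JetSec E M) : GaugeSec E M :=
  ⟨fun m => jetToGauge m (μ.1 m), fun v => by
      simp only [gaugeOp_jetToGauge]
      exact (-pairSec μ (ad v)).contMDiff, by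
      simp only [gaugeAnchor_jetToGauge]
      have h : ∀ m, jetProj m (μ.1 m) = pairSec μ gaugeOne m := fun m =>
        (pairing_gaugeEmbed m (μ.1 m) (ContinuousLinearMap.id ℝ _)).symm
      simp only [h]
      exact (pairSec μ gaugeOne).contMDiff⟩

/-- The bracket of `Γ(𝔍(TM))`:
`[μ, ν] = 𝔏_{π(μ)} ν - 𝔏_{π(ν)} μ - 𝕕⟨π(μ), ν⟩`. -/
def jetBracket (μ ν : JetSec E M) : JetSec E M :=
  lieDeriv (jetPi μ) ν - lieDeriv (jetPi ν) μ - prolong (pairSec ν (jetPi μ))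

end JetSections

/-! ### Lie algebroids -/

section Algebroids

variable {E : Type*} [NormedAddCommGroup E] [NormedSpace ℝ E]
  {M : Type*} [TopologicalSpace M] [ChartedSpace E M]

variable (E) in
/-- A family `A` of real vector spaces over `M`, together with a space of sections, an anchor and
a bracket of sections (so far subject to no axiom). -/
structure AlgebroidData (A : M → Type*) [∀ m, AddCommGroup (A m)] [∀ m, Module ℝ (A m)] where
  /-- the smooth sections -/
  sections : Submodule ℝ (∀ m, A m)
  /-- the anchor -/
  anchor : ∀ m, A m →ₗ[ℝ] Tang E m
  /-- the bracket of smooth sections -/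
  bracket : sections → sections → sections

section Axioms

variable {A B C : M → Type*}
  [∀ m, AddCommGroup (A m)] [∀ m, Module ℝ (A m)]
  [∀ m, AddCommGroup (B m)] [∀ m, Module ℝ (B m)]
  [∀ m, AddCommGroup (C m)] [∀ m, Module ℝ (C m)]

variable [IsManifold 𝓘(ℝ, E) ∞ M]

variable (E) in
/-- The family `A` of vector spaces carries the structure of a smooth vector bundle over `M` with
model fibre `F`, the smooth sections of which are exactly the elements of `Γ`. (Such a structure
is determined by `Γ`.) -/
def IsSmoothVectorBundle (F : Type*) [NormedAddCommGroup F] [NormedSpace ℝ F]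
    (Γ : Submodule ℝ (∀ m, A m)) : Prop :=
  ∃ (_ : TopologicalSpace (TotalSpace F A)) (_ : ∀ m, TopologicalSpace (A m))
    (_ : FiberBundle F A) (_ : VectorBundle ℝ F A),
    ContMDiffVectorBundle ∞ F A 𝓘(ℝ, E) ∧
    ∀ s : ∀ m, A m, s ∈ Γ ↔
      ContMDiff 𝓘(ℝ, E) (𝓘(ℝ, E).prod 𝓘(ℝ, F)) ∞ (fun m => TotalSpace.mk' F m (s m))

/-- The axioms of a Lie algebroid over `M`, the underlying vector bundle having model fibre `F`. -/
structure IsLieAlgebroid (F : Type*) [NormedAddCommGroup F] [NormedSpace ℝ F]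
    (𝒜 : AlgebroidData E A) : Prop where
  smoothBundle : IsSmoothVectorBundle E F 𝒜.sections
  anchor_smooth : ∀ s ∈ 𝒜.sections, ContMDiff 𝓘(ℝ, E) 𝓘(ℝ, E).tangent ∞
    (fun m => (⟨m, 𝒜.anchor m (s m)⟩ : TangentBundle 𝓘(ℝ, E) M))
  bracket_add : ∀ s t t', 𝒜.bracket s (t + t') = 𝒜.bracket s t + 𝒜.bracket s t'
  bracket_smul : ∀ (c : ℝ) (s t), 𝒜.bracket s (c • t) = c • 𝒜.bracket s t
  bracket_skew : ∀ s t, 𝒜.bracket s t = - 𝒜.bracket t s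
  jacobi : ∀ s t r, 𝒜.bracket s (𝒜.bracket t r)
    = 𝒜.bracket (𝒜.bracket s t) r + 𝒜.bracket t (𝒜.bracket s r)
  leibniz : ∀ (f : SmoothFn E M) (s t ft : 𝒜.sections), (∀ m, ft.1 m = f m • t.1 m) →
    ∀ m, (𝒜.bracket s ft).1 m = f m • (𝒜.bracket s t).1 m
      + mvfderiv 𝓘(ℝ, E) f m (𝒜.anchor m (s.1 m)) • t.1 m
  anchor_bracket : ∀ s t m, 𝒜.anchor m ((𝒜.bracket s t).1 m) =
    mlieBracket 𝓘(ℝ, E) (fun p => 𝒜.anchor p (s.1 p)) (fun p => 𝒜.anchor p (t.1 p)) m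

/-- A bundle map over the identity of `M` is a morphism of Lie algebroids if it is smooth and
compatible with anchors and brackets. -/
structure IsAlgebroidHom (𝒜 : AlgebroidData E A) (ℬ : AlgebroidData E B)
    (φ : ∀ m, A m →ₗ[ℝ] B m) : Prop where
  map_sections : ∀ s ∈ 𝒜.sections, (fun m => φ m (s m)) ∈ ℬ.sections
  map_anchor : ∀ m a, ℬ.anchor m (φ m a) = 𝒜.anchor m a
  map_bracket : ∀ (s t : 𝒜.sections) (m : M), φ m ((𝒜.bracket s t).1 m) =
    (ℬ.bracket ⟨fun p => φ p (s.1 p), map_sections s.1 s.2⟩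
      ⟨fun p => φ p (t.1 p), map_sections t.1 t.2⟩).1 m

/-- An isomorphism of Lie algebroids over the identity of `M`. -/
def IsAlgebroidIso (𝒜 : AlgebroidData E A) (ℬ : AlgebroidData E B)
    (φ : ∀ m, A m ≃ₗ[ℝ] B m) : Prop :=
  IsAlgebroidHom 𝒜 ℬ (fun m => (φ m).toLinearMap) ∧
    IsAlgebroidHom ℬ 𝒜 (fun m => (φ m).symm.toLinearMap)

/-- Exactness of `0 → A → B → C → 0` in each fibre. -/
def IsShortExact (i : ∀ m, A m →ₗ[ℝ] B m) (p : ∀ m, B m →ₗ[ℝ] C m) : Prop :=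
  ∀ m, Function.Injective (i m) ∧ Function.Exact (i m) (p m) ∧ Function.Surjective (p m)

end Axioms

variable [IsManifold 𝓘(ℝ, E) ∞ M] [FiniteDimensional ℝ E]

variable (E M) in
/-- `TM` with its standard Lie algebroid structure. -/
def tangentAlgebroid : AlgebroidData E (fun m : M => Tang E m) where
  sections :=
    { carrier := {u | ContMDiff 𝓘(ℝ, E) 𝓘(ℝ, E).tangent ∞
        (fun m => (⟨m, u m⟩ : TangentBundle 𝓘(ℝ, E) M))}
      add_mem' := fun ha hb => ContMDiff.add_section ha hb
      zero_mem' := (0 : VField E M).contMDiff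
      smul_mem' := fun _ _ ha => ContMDiff.const_smul_section ha }
  anchor := fun _ => LinearMap.id
  bracket := fun u v => ⟨vbracket ⟨u.1, u.2⟩ ⟨v.1, v.2⟩, (vbracket _ _).contMDiff⟩

variable (E M) in
/-- Smooth sections of `𝔤𝔩(TM) = Hom(TM, TM)`. -/
def glSections : Submodule ℝ (∀ m : M, Tang E m →L[ℝ] Tang E m) where
  carrier := {y | ContMDiff 𝓘(ℝ, E) (𝓘(ℝ, E).prod 𝓘(ℝ, E →L[ℝ] E)) ∞
    (fun m => TotalSpace.mk' (E →L[ℝ] E) (E := fun p : M => Tang E p →L[ℝ] Tang E p) m (y m))}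
  add_mem' := fun ha hb => ContMDiff.add_section ha hb
  zero_mem' := (0 : Cₛ^∞⟮𝓘(ℝ, E); E →L[ℝ] E, (fun p : M => Tang E p →L[ℝ] Tang E p)⟯).contMDiff
  smul_mem' := fun _ _ ha => ContMDiff.const_smul_section ha

lemma glSections_comp {y z : ∀ m : M, Tang E m →L[ℝ] Tang E m}
    (hy : y ∈ glSections E M) (hz : z ∈ glSections E M) :
    (fun m => (y m).comp (z m)) ∈ glSections E M := by
  intro x
  have hy' := ((contMDiffAt_hom_bundle _).1 (hy x)).2
  have hz' := ((contMDiffAt_hom_bundle _).1 (hz x)).2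
  refine (contMDiffAt_hom_bundle _).2 ⟨contMDiffAt_id, ?_⟩
  refine (hy'.clm_comp hz').congr_of_eventuallyEq ?_
  have hx : x ∈ (trivializationAt E (fun p : M => Tang E p) x).baseSet :=
    mem_baseSet_trivializationAt E _ x
  filter_upwards [(trivializationAt E (fun p : M => Tang E p) x).open_baseSet.mem_nhds hx]
    with p hp
  ext v
  simp only [ContinuousLinearMap.inCoordinates, ContinuousLinearMap.comp_apply]
  rw [Trivialization.symmL_continuousLinearMapAt _ hp]

variable (E M) in
/-- `𝔤𝔩(TM)`, with the commutator bracket and anchor zero. -/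
def glAlgebroid : AlgebroidData E (fun m : M => Tang E m →L[ℝ] Tang E m) where
  sections := glSections E M
  anchor := fun _ => 0
  bracket := fun y z => ⟨fun m => (y.1 m).comp (z.1 m) - (z.1 m).comp (y.1 m),
    (glSections E M).sub_mem (glSections_comp y.2 z.2) (glSections_comp z.2 y.2)⟩

variable (E M) in
/-- `𝔤𝔩(TM)^op`, with the opposite of the commutator bracket and anchor zero. -/
def glOpAlgebroid : AlgebroidData E (fun m : M => Tang E m →L[ℝ] Tang E m) where
  sections := glSections E M
  anchor := fun _ => 0
  bracket := fun y z => (glAlgebroid E M).bracket z y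

variable (E M) in
/-- The gauge algebroid `𝔇(TM)`. -/
def gaugeAlgebroid : AlgebroidData E (fun m : M => Gauge E m) where
  sections := gaugeSections
  anchor := gaugeAnchor
  bracket := gaugeBracket

variable [T2Space M]

variable (E M) in
/-- The jet algebroid `𝔍(TM)` of the Lie algebroid `TM`; its anchor `α ∘ π` is `𝕡`. -/
def jetAlgebroid : AlgebroidData E (fun m : M => Jet E m) where
  sections := jetSections
  anchor := fun m => (gaugeAnchor m).comp (jetToGauge m)
  bracket := jetBracket

end Algebroids

end JetGauge

end

/-! Everything rests on the bundle map $\pi:[u]_m\mapsto[u,\cdot\,](m)$ from $\mathfrak{J}(TM)$ to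
$\mathfrak{D}(TM)$, which turns out to be the isomorphism sought. An operator with anchor zero sees
only the value $u(m)$, hence is an endomorphism of $T_mM$. So every element of $\mathfrak{D}(TM)_m$
is such an endomorphism plus some $[u,\cdot\,](m)$; this gives the Atiyah sequence. Since
$\pi(\mu)(v)=-\langle\mu,[v,\cdot\,]\rangle$ and $\langle\mathbf{e}(y),[v,\cdot\,]\rangle=y(v(m))$,
one finds $\pi\circ\mathbf{e}=-\mathbf{i}$ (`jetToGauge_jetEmbed`), the source of the sign and of
the opposite bracket. With the nondegeneracy of the pairing (`pairing_nondegenerate`), the same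
decomposition shows that $\pi$ is bijective on fibres, and the jet sequence follows from the Atiyah
sequence.

The analytic heart is the formula $\langle\mu,d\rangle=d(w)-\pi(\mu)(x)-[x,w]$ with $x=\alpha(d)$
and $w=\mathbf{p}(\mu)$ (`pairing_eq`, `pairSec_eq`): the pairing depends on $\mu$ only through
$\pi(\mu)$. It shows that $\pi^{-1}$ preserves smooth sections. Substituted in the definition of the
bracket on jets, it reduces $\pi[\mu,\nu]=[\pi\mu,\pi\nu]$ to the Jacobi identity of vector fields
(`jetPi_jetBracket`). As $\pi$ is injective, the Lie algebroid axioms for jets, and the statements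
about $\mathbf{e}$ and $\mathbf{p}$, are pulled back from $\mathfrak{D}(TM)$, where the bracket is a
commutator.

That $\mathfrak{D}(TM)$ is a smooth vector bundle is shown by local frames (`gaugeFrames`): with a
frame $e_k$ of $TM$, an element is recorded by the coordinates $a_k$ of its anchor and by the matrix
of what remains after subtracting $\sum a_k[e_k,\cdot\,]$. The frames are carried to jets by $\pi$.
-/

noncomputable section

namespace JetGauge

/-! ### Fibrewise linear algebra: both exact sequences and the isomorphism -/

section Fibres

variable {E : Type*} [NormedAddCommGroup E] [NormedSpace ℝ E] [FiniteDimensional ℝ E]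
  {M : Type*} [TopologicalSpace M] [ChartedSpace E M] [IsManifold 𝓘(ℝ, E) ∞ M] [T2Space M]

/-- A smooth vector field with a prescribed value at `m`. -/
def extendVec (m : M) (x : Tang E m) : VField E M := ∑ i, (tbasis E m).repr x i • frame m i

@[simp] lemma extendVec_self (m : M) (x : Tang E m) : extendVec m x m = x := by
  rw [extendVec, field_sum_apply]
  calc _ = ∑ i, (tbasis E m).repr x i • tbasis E m i := by
        refine Finset.sum_congr rfl fun i _ => ?_
        rw [← frame_self]; rfl
    _ = x := (tbasis E m).sum_repr x

lemma gaugeOp_gaugeEmbed (m : M) (Φ : Tang E m →L[ℝ] Tang E m) (u : VField E M) :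
    gaugeOp m (gaugeEmbed m Φ) u = Φ (u m) := rfl

@[simp] lemma gaugeAnchor_gaugeEmbed (m : M) (Φ : Tang E m →L[ℝ] Tang E m) :
    gaugeAnchor m (gaugeEmbed m Φ) = 0 := rfl

lemma gaugeOp_congr_of_anchor {m : M} (d : Gauge E m) (hd : gaugeAnchor m d = 0)
    {u v : VField E M} (h : u m = v m) : gaugeOp m d u = gaugeOp m d v := by
  rw [← sub_eq_zero, ← map_sub]
  exact gaugeOp_eq_zero_of_anchor d hd (by simp [h])

/-- With zero anchor, $d(u)$ depends only on $u(m)$, so applying $d$ to any extension of $x$ gives a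
well-defined linear endomorphism. It is continuous because $T_mM$ is finite-dimensional. -/
lemma exists_gaugeEmbed_eq {m : M} (d : Gauge E m) (hd : gaugeAnchor m d = 0) :
    ∃ Φ, gaugeEmbed m Φ = d := by
  have : FiniteDimensional ℝ (Tang E m) := ‹FiniteDimensional ℝ E›
  have : T2Space (Tang E m) := inferInstanceAs (T2Space E)
  let L : Tang E m →ₗ[ℝ] Tang E m :=
    { toFun := fun x => gaugeOp m d (extendVec m x)
      map_add' := fun x y => by
        rw [← map_add]; exact gaugeOp_congr_of_anchor d hd (by simp)
      map_smul' := fun c x => by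
        rw [RingHom.id_apply, ← map_smul]; exact gaugeOp_congr_of_anchor d hd (by simp) }
  refine ⟨L.toContinuousLinearMap, gauge_ext (fun u => ?_) hd.symm⟩
  exact gaugeOp_congr_of_anchor d hd (by simp)

lemma gaugeEmbed_injective (m : M) : Function.Injective (gaugeEmbed (E := E) m) := by
  intro Φ Ψ h
  ext x
  have := congrArg (fun d => gaugeOp m d (extendVec m x)) h
  simpa [gaugeOp_gaugeEmbed] using this

lemma mvfderiv_fn_mul (f g : SmoothFn E M) (m : M) (v : Tang E m) :
    mvfderiv 𝓘(ℝ, E) (f * g : SmoothFn E M) m v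
      = f m * mvfderiv 𝓘(ℝ, E) g m v + g m * mvfderiv 𝓘(ℝ, E) f m v := by
  have h := mvfderiv_smul (I := 𝓘(ℝ, E)) (mdiff_fn f m) (mdiff_fn g m)
  have h' := congrArg (fun L : Tang E m →L[ℝ] ℝ => L v) h
  refine h'.trans ?_
  simp [mul_comm]

lemma contract_fsmul (ξ : OneForm E M) (f : SmoothFn E M) (u : VField E M) :
    contract ξ (fsmul f u) = f * contract ξ u := by
  ext m; simp [contract_apply]

lemma contract_sum {ι : Type*} (ξ : OneForm E M) (s : Finset ι) (w : ι → VField E M) :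
    contract ξ (∑ i ∈ s, w i) = ∑ i ∈ s, contract ξ (w i) :=
  map_sum ({ toFun := contract ξ, map_zero' := by ext m; simp [contract_apply],
             map_add' := contract_add ξ } : VField E M →+ SmoothFn E M) w s

lemma mvfderiv_fn_sum {ι : Type*} (s : Finset ι) (f : ι → SmoothFn E M) (m : M) (v : Tang E m) :
    mvfderiv 𝓘(ℝ, E) (∑ i ∈ s, f i : SmoothFn E M) m v
      = ∑ i ∈ s, mvfderiv 𝓘(ℝ, E) (f i) m v :=
  map_sum ({ toFun := fun g : SmoothFn E M => mvfderiv 𝓘(ℝ, E) g m v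
             map_zero' := by
              have h := mvfderiv_fn_smul (0 : ℝ) (0 : SmoothFn E M) m
              rw [zero_smul, zero_smul] at h
              exact congrArg (fun L : Tang E m →L[ℝ] ℝ => L v) h
             map_add' := fun g h => by rw [mvfderiv_fn_add]; rfl } : SmoothFn E M →+ ℝ) f s

/-- The pairing of `𝔍(TM)_m` with `𝔇(TM)_m` is nondegenerate on the left. -/
lemma pairing_nondegenerate {m : M} {μ : Jet E m} (h : ∀ d, pairing m μ d = 0) : μ = 0 := by
  induction μ using jet_induction with
  | h u =>
    -- The identity endomorphism has anchor zero and pairs with a jet to give its value.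
    have hu : u m = 0 := h (gaugeEmbed m (ContinuousLinearMap.id ℝ _))
    have hone : (bumpFn E m * bumpFn E m) m = 1 := by
      change bumpFn E m m * bumpFn E m m = 1; simp
    -- Pair with $[v,\cdot\,]$ for a field extending $v$. Expanding $b^2u$ in the frame, with $b$
    -- the bump function and $u(m)=0$, the Leibniz rule leaves a combination of basis vectors whose
    -- coefficients are the derivatives in question.
    have hc : ∀ i v, mvfderiv 𝓘(ℝ, E) (contract (coframe m i) u) m v = 0 := by
      intro i v
      have h1 := h (adAt m (extendVec m v))
      rw [pairing_jet] at h1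
      have h2 := gaugeOp_fsmul (adAt m (extendVec m v)) (bumpFn E m * bumpFn E m) u
      rw [h1, hu, smul_zero, smul_zero, add_zero, sum_coframe_fsmul, map_sum] at h2
      have h3 : ∀ j, gaugeOp m (adAt m (extendVec m v))
          (fsmul (contract (coframe m j) u) (frame m j))
          = mvfderiv 𝓘(ℝ, E) (contract (coframe m j) u) m v • tbasis E m j := by
        intro j
        rw [gaugeOp_fsmul, contract_apply, hu, map_zero, gaugeAnchor_adAt, extendVec_self,
          frame_self]
        exact (congrArg (· + _) (zero_smul ℝ _)).trans (zero_add _)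
      rw [Finset.sum_congr rfl fun j _ => h3 j] at h2
      exact linearIndependent_iff'.1 (tbasis E m).linearIndependent _ _ h2 i (Finset.mem_univ i)
    -- An arbitrary $\xi$ is reduced to the coframe:
    -- $b^2\langle\xi,u\rangle=\sum_i\langle\xi_i,u\rangle\langle\xi,e_i\rangle$, where each
    -- $\langle\xi_i,u\rangle$ vanishes at $m$ with its differential.
    have hn : u ∈ jetNull m := by
      refine ⟨hu, fun ξ => ?_⟩
      ext v
      have h1 := mvfderiv_fn_mul (bumpFn E m * bumpFn E m) (contract ξ u) m v
      rw [← contract_fsmul, sum_coframe_fsmul, contract_sum, mvfderiv_fn_sum, hone, one_mul,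
        contract_apply ξ u, hu, map_zero] at h1
      rw [Finset.sum_eq_zero] at h1
      · refine Eq.trans ?_ h1.symm
        exact ((congrArg (_ + ·) (zero_mul _)).trans (add_zero _)).symm
      · intro i _
        rw [contract_fsmul, mvfderiv_fn_mul, hc, mul_zero, contract_apply (coframe m i), hu,
          map_zero, add_comm]
        exact (congrArg (_ + ·) (zero_mul _)).trans (add_zero _)
    exact (Submodule.Quotient.mk_eq_zero _).2 hn

/-- The sign comes from exchanging the two arguments of the bracket: $\pi(\mu)$ acts on $v$ as minus
the pairing of $\mu$ with $[v,\cdot\,]$. The anchor is read off by pairing with the identity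
endomorphism, on which $\mathbf{e}(y)$ vanishes. -/
lemma jetToGauge_jetEmbed (m : M) (y : Tang E m →L[ℝ] Tang E m) :
    jetToGauge m (jetEmbed m y) = gaugeEmbed m (-y) := by
  refine gauge_ext (fun u => ?_) ?_
  · rw [gaugeOp_jetToGauge, pairing_jetEmbed, gaugeAnchor_adAt, gaugeOp_gaugeEmbed]; rfl
  · rw [gaugeAnchor_jetToGauge, gaugeAnchor_gaugeEmbed]
    have h := pairing_gaugeEmbed m (jetEmbed m y) (ContinuousLinearMap.id ℝ _)
    rw [pairing_jetEmbed, gaugeAnchor_gaugeEmbed, map_zero] at h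
    exact h.symm

@[simp] lemma jetProj_jetEmbed (m : M) (y : Tang E m →L[ℝ] Tang E m) :
    jetProj m (jetEmbed m y) = 0 := by
  rw [← gaugeAnchor_jetToGauge, jetToGauge_jetEmbed, gaugeAnchor_gaugeEmbed]

/-- If $\pi(\mu)=0$, then $\mu$ has value zero, so it pairs to zero with endomorphisms, and it pairs
to zero with every $[v,\cdot\,]$. These two kinds of elements span $\mathfrak{D}(TM)_m$, and the
pairing is nondegenerate. -/
lemma jetToGauge_injective (m : M) : Function.Injective (jetToGauge (E := E) m) := by
  rw [← LinearMap.ker_eq_bot, LinearMap.ker_eq_bot']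
  intro μ h
  refine pairing_nondegenerate fun d => ?_
  have hp : jetProj m μ = 0 := by rw [← gaugeAnchor_jetToGauge, h, map_zero]
  obtain ⟨Φ, hΦ⟩ := exists_gaugeEmbed_eq (d - adAt m (extendVec m (gaugeAnchor m d)))
    (by rw [map_sub, gaugeAnchor_adAt, extendVec_self, sub_self])
  have hd : d = gaugeEmbed m Φ + adAt m (extendVec m (gaugeAnchor m d)) := by
    rw [hΦ, sub_add_cancel]
  rw [hd, map_add, pairing_gaugeEmbed, hp, map_zero, zero_add, ← neg_eq_zero,
    ← gaugeOp_jetToGauge, h]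
  simp

/-- Split $d$ as $\mathbf{i}(\Phi)+[v,\cdot\,](m)$ with $v$ extending the anchor; the summands are
the images of $\mathbf{e}(-\Phi)$ and of the jet of $v$. -/
lemma jetToGauge_surjective (m : M) : Function.Surjective (jetToGauge (E := E) m) := by
  intro d
  obtain ⟨Φ, hΦ⟩ := exists_gaugeEmbed_eq (d - adAt m (extendVec m (gaugeAnchor m d)))
    (by rw [map_sub, gaugeAnchor_adAt, extendVec_self, sub_self])
  refine ⟨jetEmbed m (-Φ) + jet m (extendVec m (gaugeAnchor m d)), ?_⟩
  rw [map_add, jetToGauge_jetEmbed, jetToGauge_jet, neg_neg, hΦ, sub_add_cancel]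

/-- The canonical isomorphism `𝔍(TM)_m ≃ 𝔇(TM)_m`, `[u]_m ↦ [u, ·](m)`. -/
def jetEquivGauge (m : M) : Jet E m ≃ₗ[ℝ] Gauge E m :=
  LinearEquiv.ofBijective (jetToGauge m) ⟨jetToGauge_injective m, jetToGauge_surjective m⟩

@[simp] lemma jetEquivGauge_apply (m : M) (μ : Jet E m) :
    jetEquivGauge m μ = jetToGauge m μ := rfl

@[simp] lemma jetToGauge_jetEquivGauge_symm (m : M) (d : Gauge E m) :
    jetToGauge m ((jetEquivGauge m).symm d) = d :=
  (jetEquivGauge m).apply_symm_apply d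

lemma isShortExact_gauge : IsShortExact (gaugeEmbed (E := E) (M := M)) gaugeAnchor := by
  intro m
  refine ⟨gaugeEmbed_injective m, fun d => ⟨exists_gaugeEmbed_eq d, ?_⟩, fun x => ?_⟩
  · rintro ⟨Φ, rfl⟩; rfl
  · exact ⟨adAt m (extendVec m x), by rw [gaugeAnchor_adAt, extendVec_self]⟩

/-- Exactness is transported from the Atiyah sequence through $\pi$, which intertwines $\mathbf{e}$
with $-\mathbf{i}$ and $\mathbf{p}$ with $\alpha$. -/
lemma isShortExact_jet : IsShortExact (jetEmbed (E := E) (M := M)) jetProj := by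
  intro m
  refine ⟨fun y z h => ?_, fun μ => ⟨fun h => ?_, ?_⟩, fun x => ?_⟩
  · have := congrArg (jetToGauge m) h
    rw [jetToGauge_jetEmbed, jetToGauge_jetEmbed] at this
    exact neg_injective (gaugeEmbed_injective m this)
  · rw [← gaugeAnchor_jetToGauge] at h
    obtain ⟨Φ, hΦ⟩ := exists_gaugeEmbed_eq _ h
    refine ⟨-Φ, jetToGauge_injective m ?_⟩
    rw [jetToGauge_jetEmbed, neg_neg, hΦ]
  · rintro ⟨y, rfl⟩; exact jetProj_jetEmbed m y
  · exact ⟨jet m (extendVec m x), by simp⟩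

end Fibres

/-! ### The pairing in terms of operators, and compatibility of π with brackets -/

section Brackets

variable {E : Type*} [NormedAddCommGroup E] [NormedSpace ℝ E] [FiniteDimensional ℝ E]
  {M : Type*} [TopologicalSpace M] [ChartedSpace E M] [IsManifold 𝓘(ℝ, E) ∞ M] [T2Space M]

/-- The pairing with `d` of the jet corresponding to `d'`. -/
lemma pairing_eq (m : M) (μ : Jet E m) (d : Gauge E m) (x w : VField E M)
    (hx : x m = gaugeAnchor m d) (hw : w m = jetProj m μ) :
    pairing m μ d = gaugeOp m d w - gaugeOp m (jetToGauge m μ) x - vbracket x w m := by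
  -- Subtracting $[x,\cdot\,]$ from $d$ leaves an endomorphism, whose pairing with $\mu$ needs only
  -- the value $w(m)$. The subtracted part pairs to $-\pi(\mu)(x)$.
  have h0 : gaugeAnchor m (d - adAt m x) = 0 := by
    rw [map_sub, gaugeAnchor_adAt, hx, sub_self]
  have h1 : pairing m μ (d - adAt m x) = gaugeOp m (d - adAt m x) w := by
    obtain ⟨Φ, hΦ⟩ := exists_gaugeEmbed_eq _ h0
    rw [← hΦ, pairing_gaugeEmbed, gaugeOp_gaugeEmbed, hw]
  rw [gaugeOp_jetToGauge]
  rw [map_sub, map_sub, LinearMap.sub_apply, gaugeOp_adAt, sub_eq_iff_eq_add] at h1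
  rw [h1]; abel

/-- This eliminates $\mu$ in favour of $\pi(\mu)$: the anchors themselves serve as the two extending
vector fields. -/
lemma pairSec_eq (μ : JetSec E M) (d : GaugeSec E M) :
    pairSec μ d = gact d (ganchor (jetPi μ)) - gact (jetPi μ) (ganchor d)
      - vbracket (ganchor d) (ganchor (jetPi μ)) := by
  ext m
  refine pairing_eq m (μ.1 m) (d.1 m) (ganchor d) (ganchor (jetPi μ)) rfl ?_
  rw [ganchor_apply, ← gaugeAnchor_jetToGauge]; rfl

lemma gact_jetPi (μ : JetSec E M) (v : VField E M) : gact (jetPi μ) v = - pairSec μ (ad v) := by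
  ext m; exact gaugeOp_jetToGauge m (μ.1 m) v

lemma ganchor_jetPi (μ : JetSec E M) : ganchor (jetPi μ) = pairSec μ gaugeOne := by
  ext m
  exact (gaugeAnchor_jetToGauge m (μ.1 m)).trans
    (pairing_gaugeEmbed m (μ.1 m) (ContinuousLinearMap.id ℝ _)).symm

lemma jetPi_injective : Function.Injective (jetPi (E := E) (M := M)) := by
  intro μ ν h
  apply Subtype.ext
  funext m
  exact jetToGauge_injective m (congrArg (fun d : GaugeSec E M => d.1 m) h)

/-- By `pairing_eq`, the pairing of $\pi^{-1}(d)$ with $d'$ is an expression in the smooth data $d$,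
$d'$ and their anchors, so smoothness needs no coordinates. -/
lemma jetEquivGauge_symm_mem (d : GaugeSec E M) :
    (fun m => (jetEquivGauge m).symm (d.1 m)) ∈ jetSections (E := E) (M := M) := by
  intro d'
  refine ContMDiff.congr (gact d' (ganchor d) - gact d (ganchor d')
    - vbracket (ganchor d') (ganchor d)).contMDiff fun m => ?_
  have h := pairing_eq m ((jetEquivGauge m).symm (d.1 m)) (d'.1 m) (ganchor d') (ganchor d) rfl
    (by rw [← gaugeAnchor_jetToGauge, jetToGauge_jetEquivGauge_symm]; rfl)
  rw [jetToGauge_jetEquivGauge_symm] at h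
  exact congrArg _ h

lemma pairSec_sub (μ ν : JetSec E M) (d : GaugeSec E M) :
    pairSec (μ - ν) d = pairSec μ d - pairSec ν d := by
  ext m; simp [pairSec_apply]

lemma gaugeOne_bracket (d : GaugeSec E M) : gaugeBracket d gaugeOne = 0 := by
  have h0 : ganchor (gaugeOne : GaugeSec E M) = 0 := rfl
  refine gsec_ext (fun u => ?_) ?_
  · exact sub_self (gact d u)
  · rw [ganchor_gaugeBracket, h0]
    have := vbracket_smul_right (ganchor d) 0 0
    rw [zero_smul, zero_smul] at this
    exact this

lemma vbracket_neg_right (u v : VField E M) : vbracket u (-v) = -vbracket u v := by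
  simpa using vbracket_smul_right u (-1) v

lemma vbracket_sub_right (u v w : VField E M) :
    vbracket u (v - w) = vbracket u v - vbracket u w := by
  rw [sub_eq_add_neg, vbracket_add_right, vbracket_neg_right, ← sub_eq_add_neg]

lemma gact_map_neg (d : GaugeSec E M) (u : VField E M) : gact d (-u) = -gact d u := by
  ext m; simp [gact_apply]

/-- Both sides are compared as operators and by their anchors. Once the pairings are rewritten
through `pairSec_eq`, only brackets of vector fields and actions of $\pi(\mu)$, $\pi(\nu)$ remain.
-/
lemma jetPi_jetBracket (μ ν : JetSec E M) :
    jetPi (jetBracket μ ν) = gaugeBracket (jetPi μ) (jetPi ν) := by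
  refine gsec_ext (fun v => ?_) ?_
  · have hJ := vbracket_jacobi v (ganchor (jetPi μ)) (ganchor (jetPi ν))
    -- The double negations turn $\langle\nu,[v,\cdot\,]\rangle$ and $\langle\mu,[v,\cdot\,]\rangle$
    -- into $-\pi(\nu)(v)$ and $-\pi(\mu)(v)$, which already yield the commutator. All other terms
    -- must cancel.
    rw [gact_jetPi, jetBracket, pairSec_sub, pairSec_sub, pairSec_lieDeriv, pairSec_lieDeriv,
      pairSec_prolong, gact_ad, ← neg_neg (pairSec ν (ad v)), ← neg_neg (pairSec μ (ad v)),
      ← gact_jetPi, ← gact_jetPi, pairSec_eq ν, pairSec_eq μ, pairSec_eq ν]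
    simp only [ganchor_gaugeBracket, gact_gaugeBracket, ganchor_ad, gact_ad]
    generalize ganchor (jetPi μ) = x at *
    generalize ganchor (jetPi ν) = w at *
    -- What survives is the Jacobi identity for $v,x,w$; the swaps bring its terms to the same order
    -- of arguments.
    rw [vbracket_swap (vbracket v x) w] at hJ
    rw [vbracket_swap (vbracket x v) w, vbracket_swap (vbracket w v) x, vbracket_swap x v,
      vbracket_swap w v]
    simp only [gact_map_neg, vbracket_sub_right, vbracket_neg_right, hJ]
    abel
  -- The anchor is the pairing with the identity operator, which is central, so the Lie derivatives
  -- contribute just $\pi(\mu)(w)-\pi(\nu)(x)$. Subtracting $\langle\nu,\pi(\mu)\rangle$ leaves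
  -- $[x,w]$.
  · have h0 : ∀ ν : JetSec E M, pairSec ν 0 = 0 := fun ν => by ext m; simp [pairSec_apply]
    have h1 : ∀ u : VField E M, gact gaugeOne u = u := fun _ => rfl
    rw [ganchor_jetPi, jetBracket, pairSec_sub, pairSec_sub, pairSec_lieDeriv, pairSec_lieDeriv,
      pairSec_prolong, gaugeOne_bracket, gaugeOne_bracket, h0, h0, h1, pairSec_eq ν (jetPi μ),
      ganchor_gaugeBracket, ← ganchor_jetPi, ← ganchor_jetPi]
    abel

end Brackets

/-! ### Smooth vector bundles from local frames -/

section LocalFrames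

variable {E : Type*} [NormedAddCommGroup E] [NormedSpace ℝ E]
  {M : Type*} [TopologicalSpace M] [ChartedSpace E M]
  {A B : M → Type*} [∀ m, AddCommGroup (A m)] [∀ m, Module ℝ (A m)]
  [∀ m, AddCommGroup (B m)] [∀ m, Module ℝ (B m)]
  {F : Type*} [NormedAddCommGroup F] [NormedSpace ℝ F]

variable (E F) in
/-- Local frames for a space `Γ` of sections of a family `A` of vector spaces: linear coordinates
on the fibres over an open neighbourhood of each point, for which the coordinate frames extend to
global elements of `Γ` and in which `Γ` is the space of smooth sections. -/
structure LocalFrames (Γ : Submodule ℝ (∀ m, A m)) where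
  /-- the domain of the frame at `x` -/
  dom : M → Set M
  isOpen_dom : ∀ x, IsOpen (dom x)
  mem_dom : ∀ x, x ∈ dom x
  /-- the coordinates with respect to the frame at `x` -/
  coord : ∀ _ p : M, A p →ₗ[ℝ] F
  /-- the sections with constant coordinates with respect to the frame at `x` -/
  lift : M → F →ₗ[ℝ] (∀ p, A p)
  lift_mem : ∀ x v, lift x v ∈ Γ
  lift_coord : ∀ x p, p ∈ dom x → ∀ a, lift x (coord x p a) p = a
  coord_lift : ∀ x p, p ∈ dom x → ∀ v, coord x p (lift x v p) = v
  contMDiffOn_coord : ∀ s ∈ Γ, ∀ x,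
    ContMDiffOn 𝓘(ℝ, E) 𝓘(ℝ, F) ∞ (fun p => coord x p (s p)) (dom x)
  mem_of_contMDiffAt : ∀ s : ∀ p, A p,
    (∀ x, ContMDiffAt 𝓘(ℝ, E) 𝓘(ℝ, F) ∞ (fun p => coord x p (s p)) x) → s ∈ Γ

namespace LocalFrames

variable {Γ : Submodule ℝ (∀ m, A m)}

/-- The local trivialization given by a local frame. -/
def pretriv (L : LocalFrames E F Γ) (x : M) :
    Pretrivialization F (TotalSpace.proj (F := F) (E := A)) where
  toFun a := (a.1, L.coord x a.1 a.2)
  invFun y := ⟨y.1, L.lift x y.2 y.1⟩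
  source := TotalSpace.proj ⁻¹' L.dom x
  target := L.dom x ×ˢ Set.univ
  map_source' _ ha := ⟨ha, trivial⟩
  map_target' _ hy := hy.1
  left_inv' := by
    rintro ⟨p, a⟩ ha
    exact congrArg (TotalSpace.mk p) (L.lift_coord x p ha a)
  right_inv' := by
    rintro ⟨p, v⟩ hy
    exact Prod.ext rfl (L.coord_lift x p hy.1 v)
  open_target := (L.isOpen_dom x).prod isOpen_univ
  baseSet := L.dom x
  open_baseSet := L.isOpen_dom x
  source_eq := rfl
  target_eq := rfl
  proj_toFun _ _ := rfl

lemma pretriv_symm (L : LocalFrames E F Γ) {x p : M} (hp : p ∈ L.dom x) (v : F) :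
    (L.pretriv x).symm p v = L.lift x v p :=
  (L.pretriv x).symm_apply hp v

/-- The coordinate change is determined by its values on a basis of `F`. Each value consists of the
coordinates of a lifted section in `Γ`, hence is smooth; finite dimension makes the assembled
operator smooth too. -/
lemma exists_coordChange [FiniteDimensional ℝ F] (L : LocalFrames E F Γ) (x y : M) :
    ∃ f : M → F →L[ℝ] F, ContMDiffOn 𝓘(ℝ, E) 𝓘(ℝ, F →L[ℝ] F) ∞ f (L.dom x ∩ L.dom y) ∧
      ∀ p ∈ L.dom x ∩ L.dom y, ∀ v, f p v = L.coord y p ((L.pretriv x).symm p v) := by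
  let b := Module.finBasis ℝ F
  refine ⟨fun p => ∑ i, (ContinuousLinearMap.smulRightL ℝ F F
    (b.coord i).toContinuousLinearMap) (L.coord y p (L.lift x (b i) p)), ?_, fun p hp v => ?_⟩
  · refine contMDiffOn_finsetSum fun i _ => ?_
    refine ContMDiffOn.clm_apply contMDiffOn_const ?_
    exact (L.contMDiffOn_coord _ (L.lift_mem x (b i)) y).mono Set.inter_subset_right
  · rw [L.pretriv_symm hp.1]
    have h : L.lift x v p = ∑ i, b.repr v i • L.lift x (b i) p := by
      conv_lhs => rw [← b.sum_repr v]
      rw [map_sum, Finset.sum_apply]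
      simp only [map_smul, Pi.smul_apply]
    rw [h]
    simp

/-- The vector bundle charts given by local frames. -/
def prebundle [∀ m, TopologicalSpace (A m)] [FiniteDimensional ℝ F] (L : LocalFrames E F Γ)
    (h : ∀ m, Topology.IsInducing (L.coord m m)) : VectorPrebundle ℝ F A where
  pretrivializationAtlas := Set.range L.pretriv
  pretrivialization_linear' := by
    rintro _ ⟨x, rfl⟩
    exact ⟨fun p _ => (L.coord x p).isLinear⟩
  pretrivializationAt := L.pretriv
  mem_base_pretrivializationAt := L.mem_dom
  pretrivialization_mem_atlas x := ⟨x, rfl⟩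
  exists_coordChange := by
    rintro _ ⟨x, rfl⟩ _ ⟨y, rfl⟩
    obtain ⟨f, hf, hf'⟩ := L.exists_coordChange x y
    exact ⟨f, hf.continuousOn, hf'⟩
  totalSpaceMk_isInducing m := (isEmbedding_prodMkRight m).isInducing.comp (h m)

/-- The smooth coordinate changes make the frames a smooth vector prebundle. Smoothness of a section
at $x$ is tested in the trivialization centred at $x$, which is exactly the criterion built into
`LocalFrames`. -/
theorem isSmoothVectorBundle [IsManifold 𝓘(ℝ, E) ∞ M] [FiniteDimensional ℝ F]
    (L : LocalFrames E F Γ) : IsSmoothVectorBundle E F Γ := by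
  -- The fibres carry no topology beforehand; each receives the one induced by the coordinates
  -- centred at its own base point.
  let : ∀ m, TopologicalSpace (A m) := fun m => TopologicalSpace.induced (L.coord m m) inferInstance
  let a := L.prebundle fun m => ⟨rfl⟩
  have : a.IsContMDiff 𝓘(ℝ, E) ∞ := ⟨by
    rintro _ ⟨x, rfl⟩ _ ⟨y, rfl⟩
    exact L.exists_coordChange x y⟩
  let := a.totalSpaceTopology
  let := a.toFiberBundle
  let := a.toVectorBundle
  refine ⟨_, _, a.toFiberBundle, a.toVectorBundle, a.contMDiffVectorBundle 𝓘(ℝ, E), fun s => ?_⟩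
  have hs : ∀ x, ContMDiffAt 𝓘(ℝ, E) (𝓘(ℝ, E).prod 𝓘(ℝ, F)) ∞
      (fun m => TotalSpace.mk' F m (s m)) x ↔
      ContMDiffAt 𝓘(ℝ, E) 𝓘(ℝ, F) ∞ (fun p => L.coord x p (s p)) x := fun x => contMDiffAt_section x
  refine ⟨fun h x => (hs x).2 ?_, fun h => L.mem_of_contMDiffAt s fun x => (hs x).1 (h x)⟩
  exact (L.contMDiffOn_coord s h x).contMDiffAt ((L.isOpen_dom x).mem_nhds (L.mem_dom x))

/-- Transport of local frames along a fibrewise isomorphism. -/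
def congr {Γ' : Submodule ℝ (∀ m, B m)} (L : LocalFrames E F Γ) (φ : ∀ m, B m ≃ₗ[ℝ] A m)
    (h : ∀ s, s ∈ Γ' ↔ (fun m => φ m (s m)) ∈ Γ) : LocalFrames E F Γ' where
  dom := L.dom
  isOpen_dom := L.isOpen_dom
  mem_dom := L.mem_dom
  coord x p := (L.coord x p).comp (φ p).toLinearMap
  lift x :=
    { toFun := fun v p => (φ p).symm (L.lift x v p)
      map_add' := fun v w => by ext p; simp
      map_smul' := fun c v => by ext p; simp }
  lift_mem x v := by simpa [h] using L.lift_mem x v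
  lift_coord x p hp a := by simp [L.lift_coord x p hp]
  coord_lift x p hp v := by simp [L.coord_lift x p hp]
  contMDiffOn_coord s hs x := L.contMDiffOn_coord _ ((h s).1 hs) x
  mem_of_contMDiffAt s hs := (h s).2 (L.mem_of_contMDiffAt _ hs)

end LocalFrames

end LocalFrames

/-! ### Local frames for the gauge algebroid and the jet bundle -/

section GaugeFrames

variable {E : Type*} [NormedAddCommGroup E] [NormedSpace ℝ E] [FiniteDimensional ℝ E]
  {M : Type*} [TopologicalSpace M] [ChartedSpace E M] [IsManifold 𝓘(ℝ, E) ∞ M] [T2Space M]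

variable (E) in
/-- The interior of the set where the bump function at `x` equals `1`. -/
def frameDom (x : M) : Set M := interior {p | bumpFn E x p = 1}

lemma mem_frameDom (x : M) : x ∈ frameDom E x :=
  mem_interior_iff_mem_nhds.2 (bump E x).eventuallyEq_one

lemma bumpFn_of_mem {x p : M} (hp : p ∈ frameDom E x) : bumpFn E x p = 1 :=
  interior_subset (s := {p | bumpFn E x p = 1}) hp

lemma sum_coframe_of_mem {x p : M} (hp : p ∈ frameDom E x) (v : Tang E p) :
    ∑ i, coframe x i p v • frame x i p = v := by
  rw [sum_coframe, bumpFn_of_mem hp, one_mul, one_smul]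

/-- Where the bump function equals $1$ the cut-offs disappear, and frame and coframe come from
inverse maps of one trivialization. -/
lemma coframe_frame {x p : M} (hp : p ∈ frameDom E x) (i j : Fin (Module.finrank ℝ E)) :
    coframe x i p (frame x j p) = if j = i then 1 else 0 := by
  have hb : p ∈ (triv E x).baseSet := by
    by_contra h
    have := bumpFn_eq_zero h
    rw [bumpFn_of_mem hp] at this
    exact one_ne_zero this
  rw [coframe_apply, frame_apply, bumpFn_of_mem hp, one_smul, one_mul,
    ← (triv E x).symmL_apply (R := ℝ) hb, Trivialization.continuousLinearMapAt_symmL _ hb,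
    Module.Basis.repr_self, Finsupp.single_apply]

/-- The endomorphism `e_i ↦ e_j` of the model space, in terms of a basis `e`. -/
def elem (i j : Fin (Module.finrank ℝ E)) : E →L[ℝ] E :=
  ((Module.finBasis ℝ E).coord i).toContinuousLinearMap.smulRight (Module.finBasis ℝ E j)

lemma sum_elem (T : E →L[ℝ] E) :
    ∑ i, ∑ j, (Module.finBasis ℝ E).coord j (T (Module.finBasis ℝ E i)) • elem i j = T := by
  ext v
  simp only [elem, sum_apply, smul_apply, ContinuousLinearMap.smulRight_apply,
    LinearMap.coe_toContinuousLinearMap', Module.Basis.coord_apply]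
  simp_rw [smul_comm _ ((Module.finBasis ℝ E).repr v _), ← Finset.smul_sum, Module.Basis.sum_repr]
  conv_rhs => rw [← (Module.finBasis ℝ E).sum_repr v]
  simp only [map_sum, map_smul]

/-- The endomorphism `coframe i ⊗ frame j` of `T_p M`. -/
def frameElem (x p : M) (i j : Fin (Module.finrank ℝ E)) : Tang E p →L[ℝ] Tang E p :=
  (coframe x i p : Tang E p →L[ℝ] ℝ).smulRight (frame x j p)

lemma frameElem_apply (x p : M) (i j : Fin (Module.finrank ℝ E)) (v : Tang E p) :
    frameElem x p i j v = coframe x i p v • frame x j p := rfl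

/-- The `i`-th coordinate of the anchor. -/
def anchorCoord (x p : M) (i : Fin (Module.finrank ℝ E)) : Gauge E p →ₗ[ℝ] ℝ :=
  (coframe x i p : Tang E p →L[ℝ] ℝ).toLinearMap.comp (gaugeAnchor p)

lemma anchorCoord_apply (x p : M) (i : Fin (Module.finrank ℝ E)) (d : Gauge E p) :
    anchorCoord x p i d = coframe x i p (gaugeAnchor p d) := rfl

/-- The `𝔤𝔩`-part of an element of `𝔇(TM)_p` with respect to a local frame. -/
def vertPart (x p : M) : Gauge E p →ₗ[ℝ] Gauge E p :=
  LinearMap.id - ∑ k, (anchorCoord x p k).smulRight (adAt (E := E) p (frame x k))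

lemma vertPart_apply (x p : M) (d : Gauge E p) :
    vertPart x p d = d - ∑ k, anchorCoord x p k d • adAt p (frame x k) := by
  simp [vertPart]

/-- The matrix entries of the `𝔤𝔩`-part with respect to a local frame. -/
def vertCoord (x p : M) (i j : Fin (Module.finrank ℝ E)) : Gauge E p →ₗ[ℝ] ℝ :=
  ((coframe x j p : Tang E p →L[ℝ] ℝ).toLinearMap.comp ((gaugeOp p).flip (frame x i))).comp
    (vertPart x p)

lemma vertCoord_apply (x p : M) (i j : Fin (Module.finrank ℝ E)) (d : Gauge E p) :
    vertCoord x p i j d = coframe x j p (gaugeOp p (vertPart x p d) (frame x i)) := rfl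

/-- The coordinates on `𝔇(TM)_p` with respect to a local frame. -/
def gaugeCoord (x p : M) : Gauge E p →ₗ[ℝ] E × (E →L[ℝ] E) :=
  LinearMap.prod (∑ i, (anchorCoord x p i).smulRight (Module.finBasis ℝ E i))
    (∑ i, ∑ j, (vertCoord x p i j).smulRight (elem i j))

lemma gaugeCoord_apply (x p : M) (d : Gauge E p) :
    gaugeCoord x p d = (∑ i, anchorCoord x p i d • Module.finBasis ℝ E i,
      ∑ i, ∑ j, vertCoord x p i j d • elem i j) := by
  simp [gaugeCoord]

/-- The element of `𝔇(TM)_p` with prescribed coordinates. -/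
def gaugeOfCoord (x p : M) : E × (E →L[ℝ] E) →ₗ[ℝ] Gauge E p :=
  LinearMap.coprod (∑ k, ((Module.finBasis ℝ E).coord k).smulRight (adAt (E := E) p (frame x k)))
    (∑ i, ∑ j, (((Module.finBasis ℝ E).coord j).comp
      (ContinuousLinearMap.apply ℝ E (Module.finBasis ℝ E i)).toLinearMap).smulRight
        (gaugeEmbed p (frameElem x p i j)))

lemma gaugeOfCoord_apply (x p : M) (y : E × (E →L[ℝ] E)) :
    gaugeOfCoord x p y = ∑ k, (Module.finBasis ℝ E).coord k y.1 • adAt p (frame x k) +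
      ∑ i, ∑ j, (Module.finBasis ℝ E).coord j (y.2 (Module.finBasis ℝ E i)) •
        gaugeEmbed p (frameElem x p i j) := by
  simp [gaugeOfCoord]

lemma gaugeOfCoord_gaugeCoord {x p : M} (d : Gauge E p) :
    gaugeOfCoord x p (gaugeCoord x p d) = ∑ k, anchorCoord x p k d • adAt p (frame x k) +
      ∑ i, ∑ j, vertCoord x p i j d • gaugeEmbed p (frameElem x p i j) := by
  rw [gaugeOfCoord_apply, gaugeCoord_apply]
  congr 1
  · refine Finset.sum_congr rfl fun k _ => ?_
    rw [Module.Basis.coord_apply, Module.Basis.repr_sum_self]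
  · refine Finset.sum_congr rfl fun i _ => Finset.sum_congr rfl fun j _ => ?_
    congr 1
    simp [elem, sum_apply, Finsupp.single_apply, Finset.sum_ite_eq]

/-- On the domain, the frame expansion of the anchor shows that the vertical part has anchor zero,
so it is an endomorphism. That endomorphism is recovered from its matrix entries by duality of frame
and coframe. -/
lemma gaugeOfCoord_gaugeCoord_of_mem {x p : M} (hp : p ∈ frameDom E x) (d : Gauge E p) :
    gaugeOfCoord x p (gaugeCoord x p d) = d := by
  have hv : gaugeAnchor p (vertPart x p d) = 0 := by
    rw [vertPart_apply, map_sub, map_sum]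
    simp only [map_smul, gaugeAnchor_adAt, anchorCoord_apply]
    rw [sum_coframe_of_mem hp, sub_self]
  obtain ⟨Φ, hΦ⟩ := exists_gaugeEmbed_eq _ hv
  have h : ∑ i, ∑ j, vertCoord x p i j d • gaugeEmbed p (frameElem x p i j) = vertPart x p d := by
    rw [← hΦ]
    simp only [← map_smul, ← map_sum]
    congr 1
    ext w
    simp only [sum_apply, smul_apply, frameElem_apply, vertCoord_apply, ← hΦ,
      gaugeOp_gaugeEmbed]
    simp_rw [smul_comm _ (coframe x _ p w), ← Finset.smul_sum, sum_coframe_of_mem hp, ← map_smul,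
      ← map_sum, sum_coframe_of_mem hp]
  rw [gaugeOfCoord_gaugeCoord, h, vertPart_apply, add_sub_cancel]

/-- Endomorphisms do not contribute to the anchor, so the first component is recovered at once.
Taking the vertical part then removes precisely the summand it determines. -/
lemma gaugeCoord_gaugeOfCoord {x p : M} (hp : p ∈ frameDom E x) (y : E × (E →L[ℝ] E)) :
    gaugeCoord x p (gaugeOfCoord x p y) = y := by
  have h1 : ∀ k, anchorCoord x p k (gaugeOfCoord x p y) = (Module.finBasis ℝ E).coord k y.1 := by
    intro k
    rw [anchorCoord_apply, gaugeOfCoord_apply]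
    simp [gaugeAnchor_adAt, coframe_frame hp]
  have h2 : ∀ i j, vertCoord x p i j (gaugeOfCoord x p y)
      = (Module.finBasis ℝ E).coord j (y.2 (Module.finBasis ℝ E i)) := by
    intro i j
    rw [vertCoord_apply, vertPart_apply]
    simp only [h1]
    rw [gaugeOfCoord_apply, add_sub_cancel_left]
    simp [gaugeOp_gaugeEmbed, frameElem_apply, coframe_frame hp]
  rw [gaugeCoord_apply]
  refine Prod.ext ?_ ?_
  · simp only [h1]
    exact (Module.finBasis ℝ E).sum_repr y.1
  · simp only [h2]
    exact sum_elem y.2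

lemma frameElem_mem (x : M) (i j : Fin (Module.finrank ℝ E)) :
    (fun p => gaugeEmbed p (frameElem x p i j)) ∈ gaugeSections (E := E) (M := M) :=
  ⟨fun u => (fsmul (contract (coframe x i) u) (frame x j)).contMDiff, (0 : VField E M).contMDiff⟩

lemma contMDiff_anchorCoord (x : M) (d : GaugeSec E M) (i : Fin (Module.finrank ℝ E)) :
    ContMDiff 𝓘(ℝ, E) 𝓘(ℝ, ℝ) ∞ (fun p => anchorCoord x p i (d.1 p)) :=
  (contract (coframe x i) (ganchor d)).contMDiff

/-- Expanding the vertical part expresses the entry through $d(e_i)$, the brackets $[e_k,e_i]$ and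
the anchor coordinates, all of them smooth. -/
lemma contMDiff_vertCoord (x : M) (d : GaugeSec E M) (i j : Fin (Module.finrank ℝ E)) :
    ContMDiff 𝓘(ℝ, E) 𝓘(ℝ, ℝ) ∞ (fun p => vertCoord x p i j (d.1 p)) := by
  have h : ∀ p, vertCoord x p i j (d.1 p) = contract (coframe x j) (gact d (frame x i)) p -
      ∑ k, anchorCoord x p k (d.1 p) *
        contract (coframe x j) (vbracket (frame x k) (frame x i)) p := by
    intro p
    rw [vertCoord_apply, vertPart_apply, map_sub, LinearMap.sub_apply, map_sub, map_sum,
      LinearMap.sum_apply, map_sum]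
    simp only [map_smul, LinearMap.smul_apply, smul_eq_mul]
    rfl
  simp only [h]
  refine (contract _ _).contMDiff.sub (contMDiff_finsetSum fun k _ => ?_)
  exact (contMDiff_anchorCoord x d k).mul (contract _ _).contMDiff

lemma contMDiff_gaugeCoord (x : M) (d : GaugeSec E M) :
    ContMDiff 𝓘(ℝ, E) 𝓘(ℝ, E × (E →L[ℝ] E)) ∞ (fun p => gaugeCoord x p (d.1 p)) := by
  simp only [gaugeCoord_apply]
  refine ContMDiff.prodMk_space ?_ ?_
  · exact contMDiff_finsetSum fun i _ => (contMDiff_anchorCoord x d i).smul contMDiff_const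
  · exact contMDiff_finsetSum fun i _ => contMDiff_finsetSum fun j _ =>
      (contMDiff_vertCoord x d i j).smul contMDiff_const

/-- Near $x$ the section is a combination of $[e_k,\cdot\,]$ and elementary endomorphisms. Its
action on $u$ and its anchor are therefore combinations of smooth fields with coefficients smooth at
$x$. -/
lemma mem_gaugeSections_of_contMDiffAt (s : ∀ p : M, Gauge E p)
    (hs : ∀ x, ContMDiffAt 𝓘(ℝ, E) 𝓘(ℝ, E × (E →L[ℝ] E)) ∞ (fun p => gaugeCoord x p (s p)) x) :
    s ∈ gaugeSections (E := E) (M := M) := by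
  have hev : ∀ x, ∀ᶠ p in 𝓝 x, s p = gaugeOfCoord x p (gaugeCoord x p (s p)) := fun x =>
    Filter.mem_of_superset (isOpen_interior.mem_nhds (mem_frameDom x)) fun p hp =>
      (gaugeOfCoord_gaugeCoord_of_mem hp (s p)).symm
  have ha : ∀ x k, ContMDiffAt 𝓘(ℝ, E) 𝓘(ℝ, ℝ) ∞
      (fun p => (Module.finBasis ℝ E).coord k (gaugeCoord x p (s p)).1) x := fun x k =>
    ContMDiffAt.clm_apply (g := fun _ => (((Module.finBasis ℝ E).coord k).toContinuousLinearMap.comp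
      (ContinuousLinearMap.fst ℝ E (E →L[ℝ] E)))) contMDiffAt_const (hs x)
  have hb : ∀ x i j, ContMDiffAt 𝓘(ℝ, E) 𝓘(ℝ, ℝ) ∞
      (fun p => (Module.finBasis ℝ E).coord j ((gaugeCoord x p (s p)).2 (Module.finBasis ℝ E i))) x :=
    fun x i j => ContMDiffAt.clm_apply
      (g := fun _ => ((((Module.finBasis ℝ E).coord j).toContinuousLinearMap.comp
        (ContinuousLinearMap.apply ℝ E (Module.finBasis ℝ E i))).comp
        (ContinuousLinearMap.snd ℝ E (E →L[ℝ] E)))) contMDiffAt_const (hs x)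
  refine ⟨fun u x => ?_, fun x => ?_⟩
  · have h1 : ContMDiffAt 𝓘(ℝ, E) 𝓘(ℝ, E).tangent ∞ (fun p => (⟨p,
        ∑ k, (Module.finBasis ℝ E).coord k (gaugeCoord x p (s p)).1 • vbracket (frame x k) u p +
        ∑ i, ∑ j, (Module.finBasis ℝ E).coord j
          ((gaugeCoord x p (s p)).2 (Module.finBasis ℝ E i)) •
          fsmul (contract (coframe x i) u) (frame x j) p⟩ : TangentBundle 𝓘(ℝ, E) M)) x := by
      refine ContMDiffAt.add_section ?_ ?_
      · exact ContMDiffAt.sum_section fun k _ =>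
          (ha x k).smul_section (vbracket _ _).contMDiff.contMDiffAt
      · exact ContMDiffAt.sum_section fun i _ => ContMDiffAt.sum_section fun j _ =>
          (hb x i j).smul_section (fsmul _ _).contMDiff.contMDiffAt
    refine h1.congr_of_eventuallyEq ?_
    filter_upwards [hev x] with p hp
    refine congrArg (TotalSpace.mk p) ?_
    conv_lhs => rw [hp, gaugeOfCoord_apply]
    simp only [map_add, map_sum, map_smul, LinearMap.add_apply, LinearMap.sum_apply,
      LinearMap.smul_apply]
    rfl
  · have h1 : ContMDiffAt 𝓘(ℝ, E) 𝓘(ℝ, E).tangent ∞ (fun p => (⟨p,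
        ∑ k, (Module.finBasis ℝ E).coord k (gaugeCoord x p (s p)).1 • frame x k p⟩ :
          TangentBundle 𝓘(ℝ, E) M)) x :=
      ContMDiffAt.sum_section fun k _ => (ha x k).smul_section (frame x k).contMDiff.contMDiffAt
    refine h1.congr_of_eventuallyEq ?_
    filter_upwards [hev x] with p hp
    refine congrArg (TotalSpace.mk p) ?_
    conv_lhs => rw [hp, gaugeOfCoord_apply]
    simp only [map_add, map_sum, map_smul, gaugeAnchor_gaugeEmbed, gaugeAnchor_adAt, smul_zero,
      Finset.sum_const_zero, add_zero]

variable (E M) in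
/-- Local frames of the gauge algebroid of `TM`. -/
def gaugeFrames : LocalFrames E (E × (E →L[ℝ] E)) (gaugeSections (E := E) (M := M)) where
  dom := frameDom E
  isOpen_dom _ := isOpen_interior
  mem_dom := mem_frameDom
  coord := gaugeCoord
  lift x := LinearMap.pi (gaugeOfCoord x)
  lift_mem x v := by
    have h : LinearMap.pi (gaugeOfCoord x) v =
        ∑ k, (Module.finBasis ℝ E).coord k v.1 • (ad (frame x k)).1 +
        ∑ i, ∑ j, (Module.finBasis ℝ E).coord j (v.2 (Module.finBasis ℝ E i)) •
          fun p => gaugeEmbed p (frameElem x p i j) := by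
      funext p
      rw [LinearMap.pi_apply, gaugeOfCoord_apply]
      simp only [Pi.add_apply, Finset.sum_apply, Pi.smul_apply]
      rfl
    rw [h]
    refine add_mem (sum_mem fun k _ => Submodule.smul_mem _ _ (ad (frame x k)).2) ?_
    exact sum_mem fun i _ => sum_mem fun j _ => Submodule.smul_mem _ _ (frameElem_mem x i j)
  lift_coord _ _ hp := gaugeOfCoord_gaugeCoord_of_mem hp
  coord_lift _ _ hp := gaugeCoord_gaugeOfCoord hp
  contMDiffOn_coord s hs x := (contMDiff_gaugeCoord x ⟨s, hs⟩).contMDiffOn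
  mem_of_contMDiffAt := mem_gaugeSections_of_contMDiffAt

/-- This lets the jet bundle inherit its frames from $\mathfrak{D}(TM)$; the two directions are
smoothness of $\pi$ and of its inverse. -/
lemma mem_jetSections_iff (μ : ∀ m : M, Jet E m) :
    μ ∈ jetSections (E := E) (M := M) ↔
      (fun m => jetEquivGauge m (μ m)) ∈ gaugeSections (E := E) (M := M) := by
  refine ⟨fun h => (jetPi ⟨μ, h⟩).2, fun h => ?_⟩
  simpa only [LinearEquiv.symm_apply_apply] using jetEquivGauge_symm_mem ⟨_, h⟩

variable (E M) in
/-- Local frames of the first jet bundle of `TM`. -/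
def jetFrames : LocalFrames E (E × (E →L[ℝ] E)) (jetSections (E := E) (M := M)) :=
  (gaugeFrames E M).congr jetEquivGauge mem_jetSections_iff

end GaugeFrames

/-! ### Verification of the Lie algebroid axioms -/

section Algebroids

variable {E : Type*} [NormedAddCommGroup E] [NormedSpace ℝ E] [FiniteDimensional ℝ E]
  {M : Type*} [TopologicalSpace M] [ChartedSpace E M] [IsManifold 𝓘(ℝ, E) ∞ M]

lemma isLieAlgebroid_tangent : IsLieAlgebroid E (tangentAlgebroid E M) where
  smoothBundle := ⟨_, _, inferInstance, inferInstance, inferInstance, fun _ => Iff.rfl⟩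
  anchor_smooth _ hs := hs
  bracket_add s t t' := Subtype.ext <|
    congrArg (fun u : VField E M => (u : ∀ m, Tang E m))
      (vbracket_add_right ⟨s.1, s.2⟩ ⟨t.1, t.2⟩ ⟨t'.1, t'.2⟩)
  bracket_smul c s t := Subtype.ext <|
    congrArg (fun u : VField E M => (u : ∀ m, Tang E m))
      (vbracket_smul_right ⟨s.1, s.2⟩ c ⟨t.1, t.2⟩)
  bracket_skew s t := Subtype.ext <|
    congrArg (fun u : VField E M => (u : ∀ m, Tang E m))
      (vbracket_swap ⟨s.1, s.2⟩ ⟨t.1, t.2⟩)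
  jacobi s t r := Subtype.ext <|
    congrArg (fun u : VField E M => (u : ∀ m, Tang E m))
      (vbracket_jacobi ⟨s.1, s.2⟩ ⟨t.1, t.2⟩ ⟨r.1, r.2⟩)
  leibniz f s t ft h m := by
    have hft : (⟨ft.1, ft.2⟩ : VField E M) = fsmul f ⟨t.1, t.2⟩ := by ext p; exact h p
    have := vbracket_fsmul_right (⟨s.1, s.2⟩ : VField E M) ⟨t.1, t.2⟩ f
    rw [← hft] at this
    exact congrArg (fun u : VField E M => u m) this
  anchor_bracket _ _ _ := rfl

lemma isSmoothVectorBundle_gl : IsSmoothVectorBundle E (E →L[ℝ] E) (glSections E M) :=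
  ⟨_, _, inferInstance, inferInstance, inferInstance, fun _ => Iff.rfl⟩

lemma mlieBracket_zero_zero (m : M) :
    mlieBracket 𝓘(ℝ, E) (fun p => (0 : Tang E p)) (fun p => (0 : Tang E p)) m = 0 := by
  have := vbracket_smul_right (0 : VField E M) 0 0
  rw [zero_smul, zero_smul] at this
  exact congrArg (fun u : VField E M => u m) this

lemma isLieAlgebroid_gl : IsLieAlgebroid (E →L[ℝ] E) (glAlgebroid E M) where
  smoothBundle := isSmoothVectorBundle_gl
  anchor_smooth _ _ := (0 : VField E M).contMDiff
  bracket_add s t t' := by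
    apply Subtype.ext; funext m
    change (s.1 m).comp (t.1 m + t'.1 m) - (t.1 m + t'.1 m).comp (s.1 m) =
      ((s.1 m).comp (t.1 m) - (t.1 m).comp (s.1 m)) +
      ((s.1 m).comp (t'.1 m) - (t'.1 m).comp (s.1 m))
    rw [ContinuousLinearMap.comp_add, ContinuousLinearMap.add_comp]; abel
  bracket_smul c s t := by
    apply Subtype.ext; funext m
    change (s.1 m).comp (c • t.1 m) - (c • t.1 m).comp (s.1 m) =
      c • ((s.1 m).comp (t.1 m) - (t.1 m).comp (s.1 m))
    rw [ContinuousLinearMap.comp_smul, ContinuousLinearMap.smul_comp, smul_sub]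
  bracket_skew s t := by
    apply Subtype.ext; funext m
    exact (neg_sub _ _).symm
  jacobi s t r := by
    apply Subtype.ext; funext m; ext v
    change s.1 m (t.1 m (r.1 m v) - r.1 m (t.1 m v))
        - (t.1 m (r.1 m (s.1 m v)) - r.1 m (t.1 m (s.1 m v)))
      = (s.1 m (t.1 m (r.1 m v)) - t.1 m (s.1 m (r.1 m v))
          - r.1 m (s.1 m (t.1 m v) - t.1 m (s.1 m v)))
        + (t.1 m (s.1 m (r.1 m v) - r.1 m (s.1 m v))
          - (s.1 m (r.1 m (t.1 m v)) - r.1 m (s.1 m (t.1 m v))))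
    simp only [map_sub]
    abel
  leibniz f s t ft h m := by
    change (s.1 m).comp (ft.1 m) - (ft.1 m).comp (s.1 m) =
      f m • ((s.1 m).comp (t.1 m) - (t.1 m).comp (s.1 m)) + mvfderiv 𝓘(ℝ, E) f m 0 • t.1 m
    rw [h, map_zero, ContinuousLinearMap.comp_smul, ContinuousLinearMap.smul_comp, smul_sub]
    exact (add_zero _).symm.trans (congrArg (_ + ·) (zero_smul ℝ _).symm)
  anchor_bracket _ _ m := (mlieBracket_zero_zero m).symm

lemma isLieAlgebroid_glOp : IsLieAlgebroid (E →L[ℝ] E) (glOpAlgebroid E M) where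
  smoothBundle := isSmoothVectorBundle_gl
  anchor_smooth := isLieAlgebroid_gl.anchor_smooth
  bracket_add s t t' := by
    apply Subtype.ext; funext m
    change (t.1 m + t'.1 m).comp (s.1 m) - (s.1 m).comp (t.1 m + t'.1 m) =
      ((t.1 m).comp (s.1 m) - (s.1 m).comp (t.1 m)) +
      ((t'.1 m).comp (s.1 m) - (s.1 m).comp (t'.1 m))
    rw [ContinuousLinearMap.comp_add, ContinuousLinearMap.add_comp]; abel
  bracket_smul c s t := by
    apply Subtype.ext; funext m
    change (c • t.1 m).comp (s.1 m) - (s.1 m).comp (c • t.1 m) =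
      c • ((t.1 m).comp (s.1 m) - (s.1 m).comp (t.1 m))
    rw [ContinuousLinearMap.comp_smul, ContinuousLinearMap.smul_comp, smul_sub]
  bracket_skew s t := isLieAlgebroid_gl.bracket_skew t s
  jacobi s t r := by
    apply Subtype.ext; funext m; ext v
    change (r.1 m (t.1 m (s.1 m v)) - t.1 m (r.1 m (s.1 m v)))
        - s.1 m (r.1 m (t.1 m v) - t.1 m (r.1 m v))
      = (r.1 m (t.1 m (s.1 m v) - s.1 m (t.1 m v))
          - (t.1 m (s.1 m (r.1 m v)) - s.1 m (t.1 m (r.1 m v))))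
        + ((r.1 m (s.1 m (t.1 m v)) - s.1 m (r.1 m (t.1 m v)))
          - t.1 m (r.1 m (s.1 m v) - s.1 m (r.1 m v)))
    simp only [map_sub]
    abel
  leibniz f s t ft hft m := by
    change (ft.1 m).comp (s.1 m) - (s.1 m).comp (ft.1 m) =
      f m • ((t.1 m).comp (s.1 m) - (s.1 m).comp (t.1 m)) + mvfderiv 𝓘(ℝ, E) f m 0 • t.1 m
    rw [hft, map_zero, ContinuousLinearMap.comp_smul, ContinuousLinearMap.smul_comp, smul_sub]
    exact (add_zero _).symm.trans (congrArg (_ + ·) (zero_smul ℝ _).symm)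
  anchor_bracket _ _ m := (mlieBracket_zero_zero m).symm

variable [T2Space M]

lemma gaugeBracket_add_right (s t t' : GaugeSec E M) :
    gaugeBracket s (t + t') = gaugeBracket s t + gaugeBracket s t' := by
  refine gsec_ext (fun u => ?_) ?_
  · simp only [gact_gaugeBracket, gact_add, gact_map_add]; abel
  · simp only [ganchor_gaugeBracket, ganchor_add, vbracket_add_right]

lemma gaugeBracket_smul_right (c : ℝ) (s t : GaugeSec E M) :
    gaugeBracket s (c • t) = c • gaugeBracket s t := by
  refine gsec_ext (fun u => ?_) ?_
  · ext m
    change gaugeOp m (s.1 m) (c • gact t u) - (gaugeOp m (c • t.1 m)) (gact s u) =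
      gaugeOp m (c • (gaugeBracket s t).1 m) u
    rw [map_smul, map_smul, map_smul, LinearMap.smul_apply, LinearMap.smul_apply, ← smul_sub]
    rfl
  · exact vbracket_smul_right (ganchor s) c (ganchor t)

lemma gaugeBracket_swap (s t : GaugeSec E M) : gaugeBracket s t = -gaugeBracket t s := by
  refine gsec_ext (fun u => ?_) ?_
  · exact (neg_sub (gact t (gact s u)) (gact s (gact t u))).symm
  · exact vbracket_swap (ganchor s) (ganchor t)

lemma gaugeBracket_jacobi (s t r : GaugeSec E M) :
    gaugeBracket s (gaugeBracket t r) =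
      gaugeBracket (gaugeBracket s t) r + gaugeBracket t (gaugeBracket s r) := by
  refine gsec_ext (fun u => ?_) ?_
  · simp only [gact_gaugeBracket, gact_add, gact_map_sub]; abel
  · exact vbracket_jacobi (ganchor s) (ganchor t) (ganchor r)

lemma gaugeBracket_gsmul_right (f : SmoothFn E M) (s t : GaugeSec E M) :
    gaugeBracket s (gsmul f t) = gsmul f (gaugeBracket s t) + gsmul (dir (ganchor s) f) t := by
  refine gsec_ext (fun u => ?_) ?_
  · simp only [gact_gaugeBracket, gact_add, gact_gsmul, gact_fsmul]
    ext m; simp [smul_sub]; abel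
  · simp only [ganchor_gaugeBracket, ganchor_add, ganchor_gsmul, vbracket_fsmul_right]

lemma isLieAlgebroid_gauge :
    IsLieAlgebroid (E × (E →L[ℝ] E)) (gaugeAlgebroid E M) where
  smoothBundle := (gaugeFrames E M).isSmoothVectorBundle
  anchor_smooth s hs := hs.2
  bracket_add := gaugeBracket_add_right
  bracket_smul := gaugeBracket_smul_right
  bracket_skew := gaugeBracket_swap
  jacobi := gaugeBracket_jacobi
  leibniz f s t ft h m := by
    have hft : ft = gsmul f t := Subtype.ext (funext h)
    rw [hft]
    exact congrArg (fun d : GaugeSec E M => d.1 m) (gaugeBracket_gsmul_right f s t)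
  anchor_bracket _ _ _ := rfl

lemma jetPi_add (μ ν : JetSec E M) : jetPi (μ + ν) = jetPi μ + jetPi ν :=
  Subtype.ext (funext fun m => map_add (jetToGauge m) (μ.1 m) (ν.1 m))

lemma jetPi_smul (c : ℝ) (μ : JetSec E M) : jetPi (c • μ) = c • jetPi μ :=
  Subtype.ext (funext fun m => map_smul (jetToGauge m) c (μ.1 m))

lemma jetPi_neg (μ : JetSec E M) : jetPi (-μ) = -jetPi μ :=
  Subtype.ext (funext fun m => map_neg (jetToGauge m) (μ.1 m))

/-- The defining formula is not visibly skew and hides its Lie derivatives behind a choice. Applying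
the injective `jetPi` replaces it by a commutator; the same device proves the next three identities.
-/
lemma jetBracket_add_right (s t t' : JetSec E M) :
    jetBracket s (t + t') = jetBracket s t + jetBracket s t' :=
  jetPi_injective <| by simp only [jetPi_jetBracket, jetPi_add, gaugeBracket_add_right]

lemma jetBracket_smul_right (c : ℝ) (s t : JetSec E M) :
    jetBracket s (c • t) = c • jetBracket s t :=
  jetPi_injective <| by simp only [jetPi_jetBracket, jetPi_smul, gaugeBracket_smul_right]

lemma jetBracket_swap (s t : JetSec E M) : jetBracket s t = -jetBracket t s :=
  jetPi_injective <| by rw [jetPi_neg, jetPi_jetBracket, jetPi_jetBracket, gaugeBracket_swap]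

lemma jetBracket_jacobi (s t r : JetSec E M) :
    jetBracket s (jetBracket t r) =
      jetBracket (jetBracket s t) r + jetBracket t (jetBracket s r) :=
  jetPi_injective <| by
    simp only [jetPi_jetBracket, jetPi_add]
    exact gaugeBracket_jacobi _ _ _

lemma isLieAlgebroid_jet :
    IsLieAlgebroid (E × (E →L[ℝ] E)) (jetAlgebroid E M) where
  smoothBundle := (jetFrames E M).isSmoothVectorBundle
  anchor_smooth s hs := (jetPi ⟨s, hs⟩).2.2
  bracket_add := jetBracket_add_right
  bracket_smul := jetBracket_smul_right
  bracket_skew := jetBracket_swap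
  jacobi := jetBracket_jacobi
  -- Checked after applying $\pi$ in the fibre, where it is the Leibniz rule of $\mathfrak{D}(TM)$
  -- for the images of the sections.
  leibniz f s t ft h m := jetToGauge_injective m <| by
    have hb := isLieAlgebroid_gauge.leibniz f (jetPi s) (jetPi t) (jetPi ft)
      (fun p => (congrArg (jetToGauge p) (h p)).trans (map_smul _ _ _)) m
    have h1 : ∀ ν, jetToGauge m ((jetBracket s ν).1 m) =
        (gaugeBracket (jetPi s) (jetPi ν)).1 m := fun ν =>
      congrArg (fun d : GaugeSec E M => d.1 m) (jetPi_jetBracket s ν)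
    rw [map_add, map_smul, map_smul]
    refine (h1 ft).trans (hb.trans ?_)
    exact congrArg (· + _) (congrArg (f m • ·) (h1 t).symm)
  anchor_bracket s t m := by
    have h := congrArg (fun d : GaugeSec E M => gaugeAnchor m (d.1 m)) (jetPi_jetBracket s t)
    exact h

end Algebroids

/-! ### The maps of the two sequences as algebroid morphisms -/

section Morphisms

variable {E : Type*} [NormedAddCommGroup E] [NormedSpace ℝ E] [FiniteDimensional ℝ E]
  {M : Type*} [TopologicalSpace M] [ChartedSpace E M] [IsManifold 𝓘(ℝ, E) ∞ M] [T2Space M]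

lemma contMDiff_gl_apply {y : ∀ m : M, Tang E m →L[ℝ] Tang E m} (hy : y ∈ glSections E M)
    (u : VField E M) : ContMDiff 𝓘(ℝ, E) 𝓘(ℝ, E).tangent ∞
      (fun m => (⟨m, y m (u m)⟩ : TangentBundle 𝓘(ℝ, E) M)) :=
  ContMDiff.clm_bundle_apply (IB := 𝓘(ℝ, E)) (F₂ := E) hy u.contMDiff

lemma gaugeEmbed_mem {y : ∀ m : M, Tang E m →L[ℝ] Tang E m} (hy : y ∈ glSections E M) :
    (fun m => gaugeEmbed m (y m)) ∈ gaugeSections (E := E) (M := M) :=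
  ⟨contMDiff_gl_apply hy, (0 : VField E M).contMDiff⟩

/-- The fibrewise definition of $\mathbf{e}$ uses a different chart at each point, so smoothness is
tested after $\pi$, where $\mathbf{e}$ becomes $-\mathbf{i}$. -/
lemma jetEmbed_mem {y : ∀ m : M, Tang E m →L[ℝ] Tang E m} (hy : y ∈ glSections E M) :
    (fun m => jetEmbed m (y m)) ∈ jetSections (E := E) (M := M) := by
  rw [mem_jetSections_iff]
  simp only [jetEquivGauge_apply, jetToGauge_jetEmbed]
  exact gaugeEmbed_mem ((glSections E M).neg_mem hy)

lemma isAlgebroidHom_gaugeEmbed :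
    IsAlgebroidHom (glAlgebroid E M) (gaugeAlgebroid E M) gaugeEmbed where
  map_sections _ hs := gaugeEmbed_mem hs
  map_anchor _ _ := rfl
  map_bracket s t m := by
    refine gauge_ext (fun u => rfl) ?_
    exact (mlieBracket_zero_zero m).symm

lemma isAlgebroidHom_gaugeAnchor :
    IsAlgebroidHom (gaugeAlgebroid E M) (tangentAlgebroid E M) gaugeAnchor where
  map_sections _ hs := hs.2
  map_anchor _ _ := rfl
  map_bracket _ _ _ := rfl

lemma isAlgebroidHom_jetEquivGauge :
    IsAlgebroidHom (jetAlgebroid E M) (gaugeAlgebroid E M)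
      (fun m => (jetEquivGauge m).toLinearMap) where
  map_sections s hs := (jetPi ⟨s, hs⟩).2
  map_anchor _ _ := rfl
  map_bracket s t m := congrArg (fun d : GaugeSec E M => d.1 m) (jetPi_jetBracket s t)

/-- Compatibility of the inverse with anchors and brackets is automatic; only preservation of smooth
sections has to be supplied. -/
lemma IsAlgebroidHom.symm {A B : M → Type*} [∀ m, AddCommGroup (A m)] [∀ m, Module ℝ (A m)]
    [∀ m, AddCommGroup (B m)] [∀ m, Module ℝ (B m)] {𝒜 : AlgebroidData E A}
    {ℬ : AlgebroidData E B} {φ : ∀ m, A m ≃ₗ[ℝ] B m}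
    (h : IsAlgebroidHom 𝒜 ℬ (fun m => (φ m).toLinearMap))
    (hs : ∀ s ∈ ℬ.sections, (fun m => (φ m).symm (s m)) ∈ 𝒜.sections) :
    IsAlgebroidHom ℬ 𝒜 (fun m => (φ m).symm.toLinearMap) where
  map_sections := hs
  map_anchor m b := by simpa using (h.map_anchor m ((φ m).symm b)).symm
  map_bracket s t m := by
    have hb := h.map_bracket ⟨_, hs s.1 s.2⟩ ⟨_, hs t.1 t.2⟩ m
    simp only [LinearEquiv.coe_coe, LinearEquiv.apply_symm_apply] at hb
    simp only [LinearEquiv.coe_coe]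
    rw [LinearEquiv.symm_apply_eq, hb]

lemma isAlgebroidIso_jetEquivGauge :
    IsAlgebroidIso (jetAlgebroid E M) (gaugeAlgebroid E M) jetEquivGauge :=
  ⟨isAlgebroidHom_jetEquivGauge,
    isAlgebroidHom_jetEquivGauge.symm fun s hs => jetEquivGauge_symm_mem ⟨s, hs⟩⟩

/-- Since $\mathbf{p}=\alpha\circ\pi$ is the anchor of the jet algebroid, this is the fact that an
anchor preserves brackets. -/
lemma isAlgebroidHom_jetProj :
    IsAlgebroidHom (jetAlgebroid E M) (tangentAlgebroid E M) jetProj where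
  map_sections s hs := by
    have := (jetPi ⟨s, hs⟩).2.2
    simp only [jetPi, gaugeAnchor_jetToGauge] at this
    exact this
  map_anchor m μ := (gaugeAnchor_jetToGauge m μ).symm
  map_bracket s t m := by
    have h := isLieAlgebroid_jet.anchor_bracket s t m
    simp only [jetAlgebroid, LinearMap.comp_apply, gaugeAnchor_jetToGauge] at h
    exact h

/-- After $\pi$ the map is $y\mapsto\mathbf{i}(-y)$. It respects brackets because negation carries
the opposite bracket to the commutator. -/
lemma isAlgebroidHom_jetEmbed :
    IsAlgebroidHom (glOpAlgebroid E M) (jetAlgebroid E M) jetEmbed where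
  map_sections _ hs := jetEmbed_mem hs
  map_anchor m y := by
    change gaugeAnchor m (jetToGauge m (jetEmbed m y)) = 0
    rw [gaugeAnchor_jetToGauge, jetProj_jetEmbed]
  map_bracket s t m := by
    refine jetToGauge_injective m ?_
    have h1 : ∀ y : glSections E M, jetPi ⟨_, jetEmbed_mem y.2⟩ =
        (⟨_, gaugeEmbed_mem ((glSections E M).neg_mem y.2)⟩ : GaugeSec E M) := fun y =>
      Subtype.ext (funext fun p => jetToGauge_jetEmbed p (y.1 p))
    have h2 := jetPi_jetBracket ⟨_, jetEmbed_mem s.2⟩ ⟨_, jetEmbed_mem t.2⟩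
    have h2' := h2.trans (congrArg₂ gaugeBracket (h1 s) (h1 t))
    have h3 := isAlgebroidHom_gaugeEmbed.map_bracket (-s) (-t) m
    refine (jetToGauge_jetEmbed m _).trans (Eq.trans ?_
      (h3.trans (congrArg (fun d : GaugeSec E M => d.1 m) h2').symm))
    congr 1
    -- The opposite bracket, negated, against the commutator of the negatives: both are $st-ts$.
    change -((t.1 m).comp (s.1 m) - (s.1 m).comp (t.1 m)) =
      (-s.1 m).comp (-t.1 m) - (-t.1 m).comp (-s.1 m)
    simp

end Morphisms

end JetGauge

end

theorem mainTheorem7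
    {E : Type*} [NormedAddCommGroup E] [NormedSpace ℝ E] [FiniteDimensional ℝ E]
    {M : Type*} [TopologicalSpace M] [T2Space M] [ChartedSpace E M] [IsManifold 𝓘(ℝ, E) ∞ M] :
    -- the Lie algebroids involved
    JetGauge.IsLieAlgebroid E (JetGauge.tangentAlgebroid E M) ∧
    JetGauge.IsLieAlgebroid (E →L[ℝ] E) (JetGauge.glAlgebroid E M) ∧
    JetGauge.IsLieAlgebroid (E →L[ℝ] E) (JetGauge.glOpAlgebroid E M) ∧
    JetGauge.IsLieAlgebroid (E × (E →L[ℝ] E)) (JetGauge.gaugeAlgebroid E M) ∧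
    JetGauge.IsLieAlgebroid (E × (E →L[ℝ] E)) (JetGauge.jetAlgebroid E M) ∧
    -- the jet sequence
    JetGauge.IsAlgebroidHom (JetGauge.glOpAlgebroid E M) (JetGauge.jetAlgebroid E M)
      JetGauge.jetEmbed ∧
    JetGauge.IsAlgebroidHom (JetGauge.jetAlgebroid E M) (JetGauge.tangentAlgebroid E M)
      JetGauge.jetProj ∧
    JetGauge.IsShortExact (JetGauge.jetEmbed (E := E) (M := M)) JetGauge.jetProj ∧
    -- the Atiyah sequence
    JetGauge.IsAlgebroidHom (JetGauge.glAlgebroid E M) (JetGauge.gaugeAlgebroid E M)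
      JetGauge.gaugeEmbed ∧
    JetGauge.IsAlgebroidHom (JetGauge.gaugeAlgebroid E M) (JetGauge.tangentAlgebroid E M)
      JetGauge.gaugeAnchor ∧
    JetGauge.IsShortExact (JetGauge.gaugeEmbed (E := E) (M := M)) JetGauge.gaugeAnchor ∧
    -- the canonical isomorphism and the commutative diagram
    ∃ Φ : ∀ m : M, JetGauge.Jet E m ≃ₗ[ℝ] JetGauge.Gauge E m,
      (∀ (m : M) (u : JetGauge.VField E M),
        (∀ v : JetGauge.VField E M, JetGauge.gaugeOp m (Φ m (JetGauge.jet m u)) v =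
          VectorField.mlieBracket 𝓘(ℝ, E) u v m) ∧
        JetGauge.gaugeAnchor m (Φ m (JetGauge.jet m u)) = u m) ∧
      JetGauge.IsAlgebroidIso (JetGauge.jetAlgebroid E M) (JetGauge.gaugeAlgebroid E M) Φ ∧
      (∀ (m : M) (y : JetGauge.Tang E m →L[ℝ] JetGauge.Tang E m),
        Φ m (JetGauge.jetEmbed m y) = JetGauge.gaugeEmbed m (-y)) ∧
      (∀ (m : M) (μ : JetGauge.Jet E m),
        JetGauge.gaugeAnchor m (Φ m μ) = JetGauge.jetProj m μ) := by
  exact ⟨JetGauge.isLieAlgebroid_tangent, JetGauge.isLieAlgebroid_gl, JetGauge.isLieAlgebroid_glOp,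
    JetGauge.isLieAlgebroid_gauge, JetGauge.isLieAlgebroid_jet,
    JetGauge.isAlgebroidHom_jetEmbed, JetGauge.isAlgebroidHom_jetProj, JetGauge.isShortExact_jet,
    JetGauge.isAlgebroidHom_gaugeEmbed, JetGauge.isAlgebroidHom_gaugeAnchor,
    JetGauge.isShortExact_gauge,
    JetGauge.jetEquivGauge, fun _ _ => ⟨fun _ => rfl, rfl⟩,
    JetGauge.isAlgebroidIso_jetEquivGauge, JetGauge.jetToGauge_jetEmbed,
    JetGauge.gaugeAnchor_jetToGauge⟩
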